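/- Let $S^1=\mathbb R/2\pi\mathbb Z$ and $\mathbb{RP}^1=\mathbb R\cup\{\infty\}$. A projective structure $\alpha$ on $S^1$ is given by a developing map, i.e. a smooth immersion $\varphi:\mathbb R\to\mathbb{RP}^1$ with $\varphi(x+2\pi)=T\varphi(x)$ for some $T\in PGL(2,\mathbb R)$, modulo $\varphi\mapsto A\circ\varphi$, $A\in PGL(2,\mathbb R)$. For $T\in PGL(2,\mathbb R)$ let $\mathcal P_T(S^1)$ be the space of the structures whose monodromy is in the conjugacy class of $T$. The Schwarzian derivative $S(\varphi)=\frac{\varphi'''}{\varphi'}-\frac32\big(\frac{\varphi''}{\varphi'}\big)^2$ (computed in any affine coordinate of $\mathbb{RP}^1$) depends only on $\alpha$ and is an affine coordinate on the space of projective structures; a vector field $\xi\in\mathrm{Vect}(S^1)$ (smooth, $2\pi$-periodic) acts by $L_\xi\alpha=\xi S'+2\xi'S+\xi'''$, where $S=S(\varphi)$, and $T_\alpha\mathcal P_T(S^1)=\{L_\xi\alpha:\xi\in\mathrm{Vect}(S^1)\}\cong\mathrm{Vect}(S^1)/\mathrm{aut}(\alpha)$, with $\mathrm{aut}(\alpha)=\{\xi:L_\xi\alpha=0\}$.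 For every $\alpha\in\mathcal P_T(S^1)$ there is a point $x_0$ such that every tangent vector at $\alpha$ is $L_\xi\alpha$ for some $\xi$ with $\xi(x_0)=0$. For $\delta_i\alpha=L_{\xi_i}\alpha$ with $\xi_1(x_0)=\xi_2(x_0)=0$, a developing map $\varphi$ of $\alpha$, an affine parameter $t$ of $\mathbb{RP}^1$ (the standard one composed with a homography) and $\theta=\varphi^*(dt)$, put $$\omega(\delta_1\alpha,\delta_2\alpha)=\int_{x_0}^{x_0+2\pi}\frac{L_{\xi_1}\theta}{\theta}\,d\,\frac{L_{\xi_2}\theta}{\theta}.$$ The integral is a convergent ordinary integral if $t\circ\varphi$ is finite on $(x_0,x_0+2\pi)$; in general it is the Hadamard finite part at the points where $t\circ\varphi=\infty$ (the constant term as $\varepsilon\to0^+$ of the integral outside the $\varepsilon$-neighbourhoods of these points, the remaining divergent terms being polynomial in $1/\varepsilon$ without constant term). Then: 1. $\omega$ is well defined: the value exists and depends only on $\alpha,\delta_1\alpha,\delta_2\alpha$, and not on $x_0$, $\xi_1$, $\xi_2$, $\varphi$, $t$; $\omega$ is the unique family of functions on pairs of tangent vectors of $\mathcal P_T(S^1)$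 given by this integral, and it is bilinear and alternating. 2. $\omega$ is smooth and closed: its pull-back by each smooth three-parameter family $F:\mathbb R^3\to\mathcal P_T(S^1)$, with $\partial_iF=L_{\xi_i}F$ for vector fields $\xi_i$ that depend smoothly on the parameters, is a smooth closed 2-form. 3. $\omega$ is nondegenerate on every $T_\alpha\mathcal P_T(S^1)$. 4. For all $\xi_1,\xi_2\in\mathrm{Vect}(S^1)$, with $[\xi_1,\xi_2]=\xi_1\xi_2'-\xi_1'\xi_2$, $$\omega(L_{\xi_1}\alpha,L_{\xi_2}\alpha)=-\int_0^{2\pi}S(\varphi)\,[\xi_1,\xi_2]\,dx+\int_0^{2\pi}\xi_1'\,\xi_2''\,dx.$$ -/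

import Mathlib

open scoped ContDiff Topology MatrixGroups
open MeasureTheory Filter

noncomputable section

namespace CircleProj

/-! ### The projective line, immersed curves and the Schwarzian derivative -/

/-- The real projective line `ℝ ∪ {∞}`, with the action of `GL(2, ℝ)` by homographies
(scalars act trivially, so this is the action of `PGL(2, ℝ)`). -/
abbrev RP1 : Type := OnePoint ℝ

/-- The affine coordinate on the projective line. Its value at the point at infinity is
a convention. -/
def coord (p : RP1) : ℝ := p.elim 0 id

/-- A smooth immersion of the line in the projective line: near each point, in a suitable affine
chart, it is a smooth real function with nonzero derivative. -/
def IsImmersion (φ : ℝ → RP1) : Prop :=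
  ∀ x : ℝ, ∃ (g : GL (Fin 2) ℝ) (f : ℝ → ℝ), ContDiffAt ℝ ∞ f x ∧ deriv f x ≠ 0 ∧
    ∀ᶠ y in 𝓝 x, g • φ y = ((f y : ℝ) : RP1)

/-- The classical Schwarzian derivative of a real function. -/
def schwarzReal (f : ℝ → ℝ) (x : ℝ) : ℝ :=
  deriv (deriv (deriv f)) x / deriv f x - 3 / 2 * (deriv (deriv f) x / deriv f x) ^ 2

/-- The homography `t ↦ 1 / t`. -/
def invGL : GL (Fin 2) ℝ :=
  Matrix.GeneralLinearGroup.mkOfDetNeZero !![0, 1; 1, 0] (by simp [Matrix.det_fin_two])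

open Classical in
/-- The Schwarzian derivative of a curve in the projective line, computed in the affine
coordinate `t` where the curve is finite and in the coordinate `1 / t` where it is infinite. -/
def schwarz (φ : ℝ → RP1) (x : ℝ) : ℝ :=
  if φ x = OnePoint.infty then schwarzReal (fun y => coord (invGL • φ y)) x
  else schwarzReal (fun y => coord (φ y)) x

theorem contDiffAt_deriv {f : ℝ → ℝ} {x : ℝ} {n : ℕ} (h : ContDiffAt ℝ (n + 1 : ℕ) f x) :
    ContDiffAt ℝ (n : ℕ) (deriv f) x := by
  have h1 : ContDiffAt ℝ (n : ℕ) (fderiv ℝ f) x := h.fderiv_right (by norm_cast)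
  have h2 : ContDiffAt ℝ (n : ℕ) (fun y => fderiv ℝ f y 1) x := h1.clm_apply contDiffAt_const
  exact h2

theorem schwarzReal_congr {f h : ℝ → ℝ} {x : ℝ} (e : f =ᶠ[𝓝 x] h) :
    schwarzReal f x = schwarzReal h x := by
  unfold schwarzReal
  rw [e.deriv_eq, e.deriv.deriv_eq, e.deriv.deriv.deriv_eq]

theorem schwarzReal_mobius {f : ℝ → ℝ} {x : ℝ} (hf : ContDiffAt ℝ ∞ f x) (hd : deriv f x ≠ 0)
    (a b c d : ℝ) (hdet : a * d - b * c ≠ 0) (hne : c * f x + d ≠ 0) :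
    schwarzReal (fun y => (a * f y + b) / (c * f y + d)) x = schwarzReal f x := by
  have h4 : ContDiffAt ℝ (4 : ℕ) f x := contDiffAt_infty.1 hf 4
  have e4 : ∀ᶠ y in 𝓝 x, ContDiffAt ℝ (4 : ℕ) f y := h4.eventually (by simp)
  have hcont : ContinuousAt (fun y => c * f y + d) x := by
    have := hf.continuousAt
    fun_prop
  have ene : ∀ᶠ y in 𝓝 x, c * f y + d ≠ 0 := hcont.eventually_ne hne
  have D0 : ∀ y, ContDiffAt ℝ (4 : ℕ) f y → HasDerivAt f (deriv f y) y := fun y h =>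
    (h.differentiableAt (by simp)).hasDerivAt
  have D1 : ∀ y, ContDiffAt ℝ (4 : ℕ) f y → HasDerivAt (deriv f) (deriv (deriv f) y) y := by
    intro y h
    have h' : ContDiffAt ℝ (3 : ℕ) (deriv f) y := contDiffAt_deriv h
    exact (h'.differentiableAt (by simp)).hasDerivAt
  have D2 : ∀ y, ContDiffAt ℝ (4 : ℕ) f y →
      HasDerivAt (deriv (deriv f)) (deriv (deriv (deriv f)) y) y := by
    intro y h
    have h' : ContDiffAt ℝ (2 : ℕ) (deriv (deriv f)) y := contDiffAt_deriv (contDiffAt_deriv h)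
    exact (h'.differentiableAt (by simp)).hasDerivAt
  have E1 : deriv (fun y => (a * f y + b) / (c * f y + d)) =ᶠ[𝓝 x]
      fun y => (a * d - b * c) * deriv f y / (c * f y + d) ^ 2 := by
    filter_upwards [e4, ene] with y h hn
    have := (((D0 y h).const_mul a).add_const b).div (((D0 y h).const_mul c).add_const d) hn
    refine (this.congr_deriv ?_).deriv
    field_simp
    ring
  have E2 : deriv (deriv (fun y => (a * f y + b) / (c * f y + d))) =ᶠ[𝓝 x]
      fun y => (a * d - b * c) * (deriv (deriv f) y * (c * f y + d) - 2 * c * deriv f y ^ 2) /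
        (c * f y + d) ^ 3 := by
    refine E1.deriv.trans ?_
    filter_upwards [e4, ene] with y h hn
    have := ((D1 y h).const_mul (a * d - b * c)).div
      ((((D0 y h).const_mul c).add_const d).pow 2) (pow_ne_zero 2 hn)
    refine (this.congr_deriv ?_).deriv
    simp only [Pi.pow_apply]
    field_simp
    ring
  have E3 : deriv (deriv (deriv (fun y => (a * f y + b) / (c * f y + d)))) x =
      (a * d - b * c) * ((deriv (deriv (deriv f)) x * (c * f x + d)
        - 3 * c * deriv f x * deriv (deriv f) x) * (c * f x + d)
        - 3 * c * deriv f x * (deriv (deriv f) x * (c * f x + d) - 2 * c * deriv f x ^ 2)) /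
        (c * f x + d) ^ 4 := by
    rw [E2.deriv_eq]
    have h := h4
    have hn := hne
    have := ((((D2 x h).mul (((D0 x h).const_mul c).add_const d)).sub
      (((D1 x h).pow 2).const_mul (2 * c))).const_mul (a * d - b * c)).div
      ((((D0 x h).const_mul c).add_const d).pow 3) (pow_ne_zero 3 hn)
    refine (this.congr_deriv ?_).deriv
    simp only [Pi.pow_apply, Pi.mul_apply, Pi.sub_apply]
    field_simp
    ring
  unfold schwarzReal
  rw [E3, E2.eq_of_nhds, E1.eq_of_nhds]
  field_simp
  ring

theorem schwarzReal_coord_smul {f : ℝ → ℝ} {x : ℝ} (hf : ContDiffAt ℝ ∞ f x)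
    (hd : deriv f x ≠ 0) (B : GL (Fin 2) ℝ) (hB : B • ((f x : ℝ) : RP1) ≠ OnePoint.infty) :
    schwarzReal (fun y => coord (B • ((f y : ℝ) : RP1))) x = schwarzReal f x := by
  have hne : B 1 0 * f x + B 1 1 ≠ 0 := by
    intro h
    exact hB (by rw [OnePoint.smul_some_eq_ite, if_pos h])
  have hcont : ContinuousAt (fun y => B 1 0 * f y + B 1 1) x := by
    have := hf.continuousAt
    fun_prop
  have hdet : B 0 0 * B 1 1 - B 0 1 * B 1 0 ≠ 0 := by
    have := B.det_ne_zero
    rwa [Matrix.det_fin_two] at this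
  rw [← schwarzReal_mobius hf hd _ _ _ _ hdet hne]
  apply schwarzReal_congr
  filter_upwards [hcont.eventually_ne hne] with y hy
  rw [OnePoint.smul_some_eq_ite, if_neg hy]
  rfl

theorem schwarz_eq_local {φ : ℝ → RP1} {f : ℝ → ℝ} {x : ℝ} (hf : ContDiffAt ℝ ∞ f x)
    (hd : deriv f x ≠ 0) (g : GL (Fin 2) ℝ)
    (e : ∀ᶠ y in 𝓝 x, g • φ y = ((f y : ℝ) : RP1)) : schwarz φ x = schwarzReal f x := by
  have e' : ∀ᶠ y in 𝓝 x, φ y = g⁻¹ • ((f y : ℝ) : RP1) := by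
    filter_upwards [e] with y hy
    rw [← hy, inv_smul_smul]
  unfold schwarz
  split_ifs with h
  · have hB : (invGL * g⁻¹) • ((f x : ℝ) : RP1) ≠ OnePoint.infty := by
      rw [mul_smul, ← e'.self_of_nhds, h, OnePoint.smul_infty_eq_ite]
      simp [invGL, Matrix.GeneralLinearGroup.mkOfDetNeZero]
    rw [← schwarzReal_coord_smul hf hd _ hB]
    apply schwarzReal_congr
    filter_upwards [e'] with y hy
    rw [hy, mul_smul]
  · rw [e'.self_of_nhds] at h
    rw [← schwarzReal_coord_smul hf hd _ h]
    apply schwarzReal_congr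
    filter_upwards [e'] with y hy
    rw [hy]

/-- The Schwarzian derivative of an immersed curve is projectively invariant. -/
theorem schwarz_smul {φ : ℝ → RP1} (h : IsImmersion φ) (A : GL (Fin 2) ℝ) :
    schwarz (fun x => A • φ x) = schwarz φ := by
  funext x
  obtain ⟨g, f, hf, hd, e⟩ := h x
  rw [schwarz_eq_local hf hd g e]
  refine schwarz_eq_local hf hd (g * A⁻¹) ?_
  filter_upwards [e] with y hy
  rw [mul_smul, inv_smul_smul, hy]

/-! ### Projective structures on the circle `ℝ / 2πℤ` -/

/-- A developing map of a projective structure on the circle: an immersion of the universal cover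
`ℝ` in the projective line, equivariant with respect to some monodromy. -/
structure DevMap where
  toFun : ℝ → RP1
  immersion : IsImmersion toFun
  equivariant : ∃ T : GL (Fin 2) ℝ, ∀ x, toFun (x + 2 * Real.pi) = T • toFun x

/-- Two developing maps define the same projective structure when they differ by a homography. -/
instance devSetoid : Setoid DevMap where
  r φ ψ := ∃ A : GL (Fin 2) ℝ, ∀ x, ψ.toFun x = A • φ.toFun x
  iseqv :=
    { refl := fun φ => ⟨1, fun x => (one_smul _ _).symm⟩
      symm := fun {φ ψ} ⟨A, h⟩ => ⟨A⁻¹, fun x => by rw [h, inv_smul_smul]⟩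
      trans := fun {φ ψ χ} ⟨A, h⟩ ⟨B, k⟩ => ⟨B * A, fun x => by rw [k, h, mul_smul]⟩ }

/-- The space of projective structures on the circle. -/
abbrev ProjStr : Type := Quotient devSetoid

/-- The projective structure with developing map `φ`. -/
def DevMap.struct (φ : DevMap) : ProjStr := Quotient.mk devSetoid φ

/-- The Schwarzian derivative of (any developing map of) a projective structure. The space of
projective structures is an affine space over the quadratic differentials on the circle, and
`α ↦ α.schwarzian` is its affine coordinate. -/
def ProjStr.schwarzian (α : ProjStr) : ℝ → ℝ :=
  Quotient.lift (fun φ : DevMap => schwarz φ.toFun)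
    (by
      rintro φ ψ ⟨A, h⟩
      have e : ψ.toFun = fun x => A • φ.toFun x := funext h
      simp only [e, schwarz_smul φ.immersion A]) α

/-- The space of projective structures whose monodromy is the conjugacy class of `T` in
`PGL(2, ℝ)`: some developing map has monodromy exactly `T`. -/
def PT (T : GL (Fin 2) ℝ) : Type :=
  {α : ProjStr // ∃ φ : DevMap, φ.struct = α ∧ ∀ x, φ.toFun (x + 2 * Real.pi) = T • φ.toFun x}

/-! ### Vector fields and tangent vectors -/

/-- The smooth vector fields on the circle, as smooth `2π`-periodic functions. -/
def Vect : Submodule ℝ (ℝ → ℝ) where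
  carrier := {ξ | ContDiff ℝ ∞ ξ ∧ Function.Periodic ξ (2 * Real.pi)}
  add_mem' := fun h k => ⟨h.1.add k.1, h.2.add k.2⟩
  zero_mem' := ⟨contDiff_const, fun _ => rfl⟩
  smul_mem' := fun c _ h => ⟨contDiff_const.smul h.1, fun x => by simp [h.2 x]⟩

theorem hasDerivAt_iter {ξ : ℝ → ℝ} (h : ContDiff ℝ ∞ ξ) (n : ℕ) (x : ℝ) :
    HasDerivAt (deriv^[n] ξ) (deriv^[n + 1] ξ x) x := by
  have h1 : ContDiff ℝ ∞ (deriv^[n] ξ) := h.iterate_deriv n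
  rw [Function.iterate_succ_apply']
  exact (h1.differentiable (by simp) x).hasDerivAt

theorem iter_add {ξ η : ℝ → ℝ} (h : ContDiff ℝ ∞ ξ) (k : ContDiff ℝ ∞ η) (n : ℕ) :
    deriv^[n] (ξ + η) = deriv^[n] ξ + deriv^[n] η := by
  induction n with
  | zero => rfl
  | succ n ih =>
    funext x
    rw [Function.iterate_succ_apply', ih]
    exact ((hasDerivAt_iter h n x).add (hasDerivAt_iter k n x)).deriv

theorem iter_smul {ξ : ℝ → ℝ} (h : ContDiff ℝ ∞ ξ) (c : ℝ) (n : ℕ) :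
    deriv^[n] (c • ξ) = c • deriv^[n] ξ := by
  induction n with
  | zero => rfl
  | succ n ih =>
    funext x
    rw [Function.iterate_succ_apply', ih]
    exact ((hasDerivAt_iter h n x).const_mul c).deriv

/-- The infinitesimal action of vector fields on projective structures, in the affine coordinate
`q = S(φ)`: `L_ξ α = ξ q' + 2 ξ' q + ξ'''`, which is the derivative at `s = 0` of
`S(φ ∘ g_s) = (q ∘ g_s) g_s'² + S(g_s)` for a family of diffeomorphisms `g_s` of the circle that
starts at the identity with velocity `ξ`. -/
def ProjStr.lie (α : ProjStr) : Vect →ₗ[ℝ] (ℝ → ℝ) where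
  toFun ξ := fun x => ξ.1 x * deriv α.schwarzian x + 2 * deriv^[1] ξ.1 x * α.schwarzian x
    + deriv^[3] ξ.1 x
  map_add' := fun ξ η => by
    funext x
    simp only [Submodule.coe_add, iter_add ξ.2.1 η.2.1, Pi.add_apply]
    ring
  map_smul' := fun c ξ => by
    funext x
    simp only [Submodule.coe_smul, iter_smul ξ.2.1, Pi.smul_apply, smul_eq_mul, RingHom.id_apply]
    ring

/-- The tangent space at `α` of the space of structures with the same monodromy: the infinitesimal
variations `L_ξ α` of `α` by the vector fields of the circle. It is the quotient of `Vect` by the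
kernel of `ξ ↦ L_ξ α`, the Lie algebra of infinitesimal automorphisms of `α`. -/
abbrev ProjStr.Tangent (α : ProjStr) : Submodule ℝ (ℝ → ℝ) := LinearMap.range α.lie

/-- The tangent vector `L_ξ α`. -/
def ProjStr.vel (α : ProjStr) (ξ : Vect) : α.Tangent := α.lie.rangeRestrict ξ

/-! ### The integral defining the form -/

/-- The Lie derivative along `ξ d/dx` of the 1-form `θ dx`. -/
def lieForm (ξ θ : ℝ → ℝ) (x : ℝ) : ℝ := ξ x * deriv θ x + deriv ξ x * θ x

/-- The density of `(L_{ξ₁} θ / θ) d(L_{ξ₂} θ / θ)` on the line. -/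
def density (θ ξ₁ ξ₂ : ℝ → ℝ) (x : ℝ) : ℝ :=
  (lieForm ξ₁ θ x / θ x) * deriv (fun y => lieForm ξ₂ θ y / θ y) x

/-- The 1-form `θ = φ^* dt`, where `t = coord ∘ g` is the affine parameter of the projective line
attached to the homography `g`. -/
def pullForm (g : GL (Fin 2) ℝ) (φ : DevMap) : ℝ → ℝ := deriv (fun x => coord (g • φ.toFun x))

/-- The points where the parameter `t = coord ∘ g` is infinite along `φ`. -/
def poles (g : GL (Fin 2) ℝ) (φ : DevMap) : Set ℝ := {x | g • φ.toFun x = OnePoint.infty}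

/-- The interval `[a, b]` without the open `ε`-neighbourhood of `P`. -/
def excised (P : Set ℝ) (a b ε : ℝ) : Set ℝ := {x ∈ Set.Icc a b | ∀ p ∈ P, ε ≤ |x - p|}

/-- `l` is the Hadamard finite part of `∫_a^b f`, where `f` may be singular at the points of `P`:
the integral of `f` outside the `ε`-neighbourhood of `P` is a polynomial in `1 / ε` without constant
term, plus a quantity that tends to `l` as `ε` decreases to `0`. If `f` is integrable on `[a, b]`
and `P` is finite, this says that `l` is the integral of `f`. -/
def HasFinitePart (P : Set ℝ) (f : ℝ → ℝ) (a b l : ℝ) : Prop :=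
  (∀ ε > 0, IntegrableOn f (excised P a b ε)) ∧
  ∃ p : Polynomial ℝ, p.coeff 0 = 0 ∧
    Tendsto (fun ε : ℝ => (∫ x in excised P a b ε, f x) - p.eval ε⁻¹) (𝓝[>] 0) (𝓝 l)

/-- The value of `σ` on `L_{ξ₁} α` and `L_{ξ₂} α` is `∫ (L_{ξ₁} θ / θ) d(L_{ξ₂} θ / θ)`, for all
choices of the developing map, of the affine parameter, of the point `x₀` and of the vector fields
`ξ₁`, `ξ₂` vanishing at it. The circle is cut at `x₀`. -/
def IsGivenByIntegral {T : GL (Fin 2) ℝ} (σ : ∀ α : PT T, α.1.Tangent → α.1.Tangent → ℝ) : Prop :=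
  ∀ (α : PT T) (φ : DevMap), φ.struct = α.1 → ∀ (g : GL (Fin 2) ℝ) (x₀ : ℝ) (ξ₁ ξ₂ : Vect),
    ξ₁.1 x₀ = 0 → ξ₂.1 x₀ = 0 →
      HasFinitePart (poles g φ) (density (pullForm g φ) ξ₁.1 ξ₂.1) x₀ (x₀ + 2 * Real.pi)
        (σ α (α.1.vel ξ₁) (α.1.vel ξ₂))

/-! ### Closed forms -/

/-- A smooth three-parameter family in the space of structures with monodromy `T`: the structure
`F s` depends smoothly on `s`, and its partial derivatives are the tangent vectors
`∂ᵢ F = L_{ξᵢ} F`, with vector fields `ξᵢ` that depend smoothly on `s`. -/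
structure IsSmoothFamily {T : GL (Fin 2) ℝ} (F : (Fin 3 → ℝ) → PT T)
    (ξ : Fin 3 → (Fin 3 → ℝ) → Vect) : Prop where
  smooth : ContDiff ℝ ∞ (fun p : (Fin 3 → ℝ) × ℝ => (F p.1).1.schwarzian p.2)
  smooth_field : ∀ i, ContDiff ℝ ∞ (fun p : (Fin 3 → ℝ) × ℝ => (ξ i p.1).1 p.2)
  velocity : ∀ i s x,
    fderiv ℝ (fun r => (F r).1.schwarzian x) s (Pi.single i 1) = (F s).1.lie (ξ i s) x

/-- A 2-form is smooth and closed when its pull-back `∑ Ωᵢⱼ dsᵢ ∧ dsⱼ` by each smooth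
three-parameter family is smooth and closed. -/
def IsSmoothClosed {T : GL (Fin 2) ℝ} (σ : ∀ α : PT T, LinearMap.BilinForm ℝ α.1.Tangent) : Prop :=
  ∀ (F : (Fin 3 → ℝ) → PT T) (ξ : Fin 3 → (Fin 3 → ℝ) → Vect), IsSmoothFamily F ξ →
    ∀ Ω : Fin 3 → Fin 3 → (Fin 3 → ℝ) → ℝ,
      (∀ i j s, Ω i j s = σ (F s) ((F s).1.vel (ξ i s)) ((F s).1.vel (ξ j s))) →
      (∀ i j, ContDiff ℝ ∞ (Ω i j)) ∧
      ∀ s, fderiv ℝ (Ω 1 2) s (Pi.single 0 1) + fderiv ℝ (Ω 2 0) s (Pi.single 1 1)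
        + fderiv ℝ (Ω 0 1) s (Pi.single 2 1) = 0

end CircleProj

end

/-! Write ρ = θ'/θ for the logarithmic derivative of the form and S for the Schwarzian. The
definition of S is the Riccati equation ρ' = S + ρ²/2 (`hasDerivAt_logDer`), and L_ξθ/θ = ξρ + ξ'.
Substituting, the integrand equals the smooth density -S(ξ₁ξ₂' - ξ₁'ξ₂) + ξ₁'ξ₂'' plus the
derivative of W = ρξ₁ξ₂' + ρ²ξ₁ξ₂/2 (`hasDerivAt_potential`). At a pole of the parameter ρ has
residue -2, so W has a pole of order at most two; its regular value is the same on both sides and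
cancels in the finite part. At an endpoint W contributes 0, because the fields vanish there and, at
a pole, the residue -2 gives (-2 + 2)ξ₁'ξ₂' = 0 (`potential_at_pole`). Hence every choice yields the
integral of the smooth density over a period (`hasFinitePart_density`).

Integration by parts turns that integral into ∫ (L_ξ₁α) ξ₂, where ξ ↦ L_ξα = ξ''' + 2Sξ' + S'ξ is
skew-adjoint. So the value descends to tangent vectors and is alternating. It is nondegenerate,
since L_ξα can be paired with itself regarded as a vector field. Closedness follows from equality of
mixed second derivatives of the family together with a cyclic identity for L
(`integral_cocycle_eq_zero`).

Uniqueness needs representatives vanishing at a common point. A nonscalar matrix commuting with the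
monodromy pulls back under the developing map to a nonzero periodic automorphism field
(`exists_automorphism`); subtracting multiples of it makes any field vanish where it does not. -/

noncomputable section

namespace CircleProj

/-! ### Integrals with parameters -/

section Parametric

variable {E H : Type} [NormedAddCommGroup E] [NormedSpace ℝ E] [NormedAddCommGroup H]
  [NormedSpace ℝ H]

theorem hasFDerivAt_parametric_integral {F : E × ℝ → H} (hF : ContDiff ℝ 1 F) (a b : ℝ) (s : E) :
    HasFDerivAt (fun s => ∫ x in a..b, F (s, x))
      (∫ x in a..b, (fderiv ℝ F (s, x)).comp (ContinuousLinearMap.inl ℝ E ℝ)) s := by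
  have hc : Continuous fun p : E × ℝ =>
      (fderiv ℝ F p).comp (ContinuousLinearMap.inl ℝ E ℝ) := by
    have := hF.continuous_fderiv (by simp)
    fun_prop
  obtain ⟨C, hC⟩ := (isCompact_singleton (x := s)).prod (isCompact_uIcc (a := a) (b := b))
    |>.exists_bound_of_continuousOn hc.continuousOn
  have hopen : IsOpen {p : E × ℝ |
      ‖(fderiv ℝ F p).comp (ContinuousLinearMap.inl ℝ E ℝ)‖ < C + 1} :=
    isOpen_lt hc.norm continuous_const
  -- The tube lemma spreads the bound over {s} × [a, b] to a neighbourhood of s, giving a constant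
  -- dominating function even when E is not locally compact.
  obtain ⟨u, v, hu, -, hsu, hv, huv⟩ := generalized_tube_lemma (isCompact_singleton (x := s))
    (isCompact_uIcc (a := a) (b := b)) hopen
    (fun p hp => (hC p hp).trans_lt (lt_add_one C))
  refine (intervalIntegral.hasFDerivAt_integral_of_dominated_of_fderiv_le
    (F' := fun s x => (fderiv ℝ F (s, x)).comp (ContinuousLinearMap.inl ℝ E ℝ))
    (bound := fun _ => C + 1)
    (hu.mem_nhds (hsu rfl)) ?_ ?_ ?_ ?_ ?_ ?_)
  · exact Eventually.of_forall fun s' =>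
      (hF.continuous.comp (Continuous.prodMk_right s')).aestronglyMeasurable
  · exact (hF.continuous.comp (Continuous.prodMk_right s)).intervalIntegrable _ _
  · exact (hc.comp (Continuous.prodMk_right s)).aestronglyMeasurable
  · exact Eventually.of_forall fun x hx s' hs' =>
      (huv (Set.mk_mem_prod hs' (hv (Set.uIoc_subset_uIcc hx)))).le
  · exact intervalIntegrable_const
  · refine Eventually.of_forall fun x _ s' _ => ?_
    have h1 : HasFDerivAt F (fderiv ℝ F (s', x)) (s', x) :=
      (hF.differentiable (by simp) _).hasFDerivAt
    exact h1.comp s' (hasFDerivAt_prodMk_left s' x)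

/-- The codomain is quantified inside the induction because the derivative takes values in
continuous linear maps into it. -/
theorem contDiff_parametric_integral_nat (n : ℕ) :
    ∀ {H : Type} [NormedAddCommGroup H] [NormedSpace ℝ H] {F : E × ℝ → H},
      ContDiff ℝ n F → ∀ a b : ℝ, ContDiff ℝ n fun s => ∫ x in a..b, F (s, x) := by
  induction n with
  | zero =>
    intro H _ _ F hF a b
    rw [Nat.cast_zero, contDiff_zero] at *
    exact intervalIntegral.continuous_parametric_intervalIntegral_of_continuous'
      (f := fun s x => F (s, x)) hF a b
  | succ n ih =>
    intro H _ _ F hF a b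
    have hF1 : ContDiff ℝ 1 F := hF.of_le (by norm_cast; omega)
    have hF' : ContDiff ℝ n (fun p => (fderiv ℝ F p).comp (ContinuousLinearMap.inl ℝ E ℝ)) :=
      (hF.fderiv_right (by norm_cast)).clm_comp contDiff_const
    push_cast
    rw [contDiff_succ_iff_hasFDerivAt]
    exact ⟨_, ih hF' a b, fun s => hasFDerivAt_parametric_integral hF1 a b s⟩

theorem contDiff_parametric_integral {F : E × ℝ → H} (hF : ContDiff ℝ ∞ F) (a b : ℝ) :
    ContDiff ℝ ∞ fun s => ∫ x in a..b, F (s, x) :=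
  contDiff_infty.2 fun n => contDiff_parametric_integral_nat n (contDiff_infty.1 hF n) a b

end Parametric

/-! ### Division of smooth functions by `x - p` -/

theorem contDiff_deriv {f : ℝ → ℝ} (hf : ContDiff ℝ ∞ f) : ContDiff ℝ ∞ (deriv f) :=
  hf.iterate_deriv 1

theorem hasDerivAt_of_contDiff {f : ℝ → ℝ} (hf : ContDiff ℝ ∞ f) (x : ℝ) :
    HasDerivAt f (deriv f x) x :=
  (hf.differentiable (by simp) x).hasDerivAt

/-- Hadamard's lemma on the line. -/
theorem exists_smooth_quotient {f : ℝ → ℝ} (hf : ContDiff ℝ ∞ f) (p : ℝ) :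
    ∃ h : ℝ → ℝ, ContDiff ℝ ∞ h ∧ h p = deriv f p ∧ ∀ x, f x = f p + (x - p) * h x := by
  have hf' := contDiff_deriv hf
  -- The quotient is the mean of f' over the segment from p to x, hence smooth in x.
  refine ⟨fun x => ∫ τ in (0 : ℝ)..1, deriv f (p + τ * (x - p)), ?_, ?_, fun x => ?_⟩
  · exact contDiff_parametric_integral (F := fun q : ℝ × ℝ => deriv f (p + q.2 * (q.1 - p)))
      (by fun_prop) 0 1
  · simp
  · have key : ∫ τ in (0 : ℝ)..1, deriv f (p + τ * (x - p)) * (x - p) =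
        f (p + 1 * (x - p)) - f (p + 0 * (x - p)) := by
      refine intervalIntegral.integral_eq_sub_of_hasDerivAt
        (f := fun τ => f (p + τ * (x - p))) (fun τ _ => ?_) ?_
      · have h1 : HasDerivAt (fun τ : ℝ => p + τ * (x - p)) (x - p) τ := by
          simpa using ((hasDerivAt_id τ).mul_const (x - p)).const_add p
        exact (hasDerivAt_of_contDiff hf _).comp τ h1
      · have := hf'.continuous
        exact Continuous.intervalIntegrable (by fun_prop) _ _
    rw [intervalIntegral.integral_mul_const] at key
    simp only [one_mul, add_sub_cancel, zero_mul, add_zero] at key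
    linarith

/-- Multiplication by a bump function makes a germ global, so that Hadamard's lemma applies to chart
expressions, which are smooth only locally. -/
theorem exists_contDiff_eventuallyEq {f : ℝ → ℝ} {p : ℝ}
    (hf : ∀ᶠ x in 𝓝 p, ContDiffAt ℝ ∞ f x) : ∃ F : ℝ → ℝ, ContDiff ℝ ∞ F ∧ F =ᶠ[𝓝 p] f := by
  obtain ⟨δ, hδ, hb⟩ := Metric.eventually_nhds_iff_ball.1 hf
  let χ : ContDiffBump p := ⟨δ / 4, δ / 2, by positivity, by linarith⟩
  refine ⟨fun x => χ x * f x, contDiff_iff_contDiffAt.2 fun x => ?_, ?_⟩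
  · by_cases hx : x ∈ Metric.ball p δ
    · exact χ.contDiff.contDiffAt.mul (hb x hx)
    · have hx' : x ∉ tsupport χ := by
        rw [χ.tsupport_eq]
        intro h
        have h1 : dist x p ≤ δ / 2 := h
        have h2 : ¬ dist x p < δ := hx
        linarith
      have h0 : (fun x => χ x * f x) =ᶠ[𝓝 x] fun _ => 0 := by
        filter_upwards [(notMem_tsupport_iff_eventuallyEq.1 hx')] with y hy
        simp [hy]
      exact contDiffAt_const.congr_of_eventuallyEq h0
  · filter_upwards [χ.eventuallyEq_one] with x hx
    simp [hx]

/-! ### Relations between reals that are determined locally -/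

/-- Continuous induction: the c for which r a y holds on all of (a, c] form a closed set in [a, b]
that can be continued to the right. It avoids listing the poles of an interval. -/
theorem rel_of_local {r : ℝ → ℝ → Prop} {a b : ℝ} (hab : a < b)
    (trans : ∀ x y z, x < y → y < z → r x y → r y z → r x z)
    (right : ∀ x ∈ Set.Ico a b, ∀ᶠ y in 𝓝[>] x, r x y)
    (left : ∀ x ∈ Set.Ioc a b, ∀ᶠ y in 𝓝[<] x, r y x) : r a b := by
  let s : Set ℝ := {c | ∀ y ∈ Set.Ioc a c, r a y}
  have step : ∀ x ∈ Set.Ioc a b, (∀ y ∈ Set.Ioo a x, r a y) → r a x := by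
    intro x hx h
    obtain ⟨y, hy, hy'⟩ := ((left x hx).and (Ioo_mem_nhdsLT hx.1)).exists
    exact trans a y x hy'.1 hy'.2 (h y hy') hy
  have hs : IsClosed (s ∩ Set.Icc a b) := by
    refine isClosed_of_closure_subset fun x hx => ?_
    have hx' : x ∈ Set.Icc a b :=
      closure_minimal Set.inter_subset_right isClosed_Icc hx
    refine ⟨?_, hx'⟩
    have hlt : ∀ y ∈ Set.Ioo a x, r a y := by
      intro y hy
      obtain ⟨z, hz, hz'⟩ := mem_closure_iff.1 hx (Set.Ioi y) isOpen_Ioi hy.2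
      exact hz'.1 y ⟨hy.1, le_of_lt hz⟩
    intro y hy
    rcases hy.2.lt_or_eq with h | rfl
    · exact hlt y ⟨hy.1, h⟩
    · exact step y ⟨hy.1, hx'.2⟩ hlt
  refine hs.Icc_subset_of_forall_mem_nhdsWithin (fun y hy => absurd hy.1 (not_lt.2 hy.2)) ?_
    (Set.right_mem_Icc.2 hab.le) b ⟨hab, le_rfl⟩
  rintro x ⟨hxs, hx⟩
  obtain ⟨u, hu, hu'⟩ := (mem_nhdsGT_iff_exists_Ioo_subset).1 (right x hx)
  filter_upwards [Ioo_mem_nhdsGT hu] with y hy z hz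
  rcases lt_or_ge x z with h | h
  · have h1 : r x z := hu' ⟨h, hz.2.trans_lt hy.2⟩
    rcases hx.1.lt_or_eq with h2 | rfl
    · exact trans a x z h2 h (hxs x ⟨h2, le_rfl⟩) h1
    · exact h1
  · exact hxs z ⟨hz.1, h⟩

/-! ### Finite parts -/

/-- The difference of the two divergent parts is a polynomial with a finite limit at infinity, hence
constant, and its constant term is zero. -/
theorem finitePart_unique {P : Set ℝ} {f : ℝ → ℝ} {a b l l' : ℝ} (h : HasFinitePart P f a b l)
    (h' : HasFinitePart P f a b l') : l = l' := by
  obtain ⟨-, p, hp, hl⟩ := h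
  obtain ⟨-, p', hp', hl'⟩ := h'
  have h1 : Tendsto (fun ε : ℝ => (p' - p).eval ε⁻¹) (𝓝[>] 0) (𝓝 (l - l')) := by
    refine (hl.sub hl').congr fun ε => ?_
    rw [Polynomial.eval_sub]
    ring
  have h2 : Tendsto (fun x : ℝ => (p' - p).eval x) atTop (𝓝 (l - l')) := by
    refine (h1.comp tendsto_inv_atTop_nhdsGT_zero).congr fun x => ?_
    simp
  obtain ⟨h3, h4⟩ := (Polynomial.tendsto_nhds_iff _).1 h2
  have h5 : (p' - p).leadingCoeff = 0 := by
    rw [Polynomial.leadingCoeff, Polynomial.natDegree_eq_zero_iff_degree_le_zero.2 h4,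
      Polynomial.coeff_sub, hp, hp', sub_zero]
  linarith

theorem isCompact_excised (P : Set ℝ) (a b ε : ℝ) : IsCompact (excised P a b ε) := by
  have : excised P a b ε = Set.Icc a b ∩ ⋂ p ∈ P, {x | ε ≤ |x - p|} := by
    ext x
    simp [excised]
  rw [this]
  exact isCompact_Icc.inter_right
    (isClosed_biInter fun p _ => isClosed_le continuous_const (by fun_prop))

theorem integrableOn_excised {P : Set ℝ} {f : ℝ → ℝ} (hf : ∀ x ∉ P, ContinuousAt f x)
    (a b : ℝ) {ε : ℝ} (hε : 0 < ε) : IntegrableOn f (excised P a b ε) := by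
  refine ContinuousOn.integrableOn_compact (isCompact_excised P a b ε) fun x hx => ?_
  refine (hf x fun hP => ?_).continuousWithinAt
  have := hx.2 x hP
  simp only [sub_self, abs_zero] at this
  linarith

/-- The excised neighbourhoods depend on P and not on the interval, so the domain may be cut
anywhere, even at a pole: the two pieces overlap at most in {b}. -/
theorem HasFinitePart.trans {P : Set ℝ} {f : ℝ → ℝ} {a b c l l' : ℝ} (hab : a ≤ b) (hbc : b ≤ c)
    (h : HasFinitePart P f a b l) (h' : HasFinitePart P f b c l') :
    HasFinitePart P f a c (l + l') := by
  obtain ⟨hi, p, hp, hl⟩ := h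
  obtain ⟨hi', p', hp', hl'⟩ := h'
  have hU : ∀ ε, excised P a c ε = excised P a b ε ∪ excised P b c ε := by
    intro ε
    ext x
    simp only [excised, Set.mem_ofPred_eq, Set.mem_union, ← or_and_right]
    rw [← Set.mem_union, Set.Icc_union_Icc_eq_Icc hab hbc]
  have hd : ∀ ε, AEDisjoint volume (excised P a b ε) (excised P b c ε) := by
    intro ε
    refine measure_mono_null (t := {b}) ?_ (by simp)
    rintro x ⟨h1, h2⟩
    exact le_antisymm h1.1.2 h2.1.1
  refine ⟨fun ε hε => by rw [hU]; exact (hi ε hε).union (hi' ε hε), p + p', by simp [hp, hp'], ?_⟩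
  refine (hl.add hl').congr' ?_
  filter_upwards [self_mem_nhdsWithin] with ε hε
  rw [hU, setIntegral_union₀ (hd ε) (isCompact_excised P b c ε).measurableSet.nullMeasurableSet
    (hi ε hε) (hi' ε hε), Polynomial.eval_add]
  ring

/-- The margin δ is needed because the neighbourhood of a pole outside [a, b] could still bite into
the interval. -/
theorem hasFinitePart_of_no_poles {P : Set ℝ} {f : ℝ → ℝ} (hf : ∀ x ∉ P, ContinuousAt f x)
    {a b δ : ℝ} (hδ : 0 < δ) (hab : a ≤ b) (hP : ∀ p ∈ P, p ≤ a - δ ∨ b + δ ≤ p) :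
    HasFinitePart P f a b (∫ x in a..b, f x) := by
  refine ⟨fun ε hε => integrableOn_excised hf a b hε, 0, by simp, ?_⟩
  refine tendsto_const_nhds.congr' ?_
  filter_upwards [Ioo_mem_nhdsGT hδ] with ε hε
  have : excised P a b ε = Set.Icc a b := by
    refine Set.Subset.antisymm (fun x hx => hx.1) fun x hx => ⟨hx, fun p hp => ?_⟩
    have h1 := hx.1
    have h2 := hx.2
    have h3 := hε.2
    rcases hP p hp with h | h
    · exact le_trans (by linarith) (le_abs_self _)
    · exact le_trans (by linarith) (neg_le_abs _)
  rw [this, intervalIntegral.integral_of_le hab, integral_Icc_eq_integral_Ioc]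
  simp

/-! ### Finite parts on an interval with a pole at one end -/

section PoleAtEndpoint

variable {P : Set ℝ} {f G W K : ℝ → ℝ} {p δ k₀ k₁ : ℝ}

theorem integral_eq_sub_add_integral {c d : ℝ} (hf : ∀ x ∈ Set.uIcc c d, ContinuousAt f x)
    (hG : Continuous G) (hW : ∀ x ∈ Set.uIcc c d, HasDerivAt W (f x - G x) x) :
    ∫ x in c..d, f x = W d - W c + ∫ x in c..d, G x := by
  have hfi : IntervalIntegrable f volume c d :=
    ContinuousOn.intervalIntegrable fun x hx => (hf x hx).continuousWithinAt
  have hGi : IntervalIntegrable G volume c d := hG.intervalIntegrable _ _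
  have := intervalIntegral.integral_eq_sub_of_hasDerivAt hW (hfi.sub hGi)
  rw [intervalIntegral.integral_sub hfi hGi] at this
  linarith

theorem hasFinitePart_of_left_pole (hf : ∀ x ∉ P, ContinuousAt f x) (hG : Continuous G)
    (hp : p ∈ P) (hP : ∀ x ∈ P, |x - p| < δ → x = p)
    (hW : ∀ x, x ≠ p → |x - p| < δ → HasDerivAt W (f x - G x) x)
    (hK : ContinuousAt K p)
    (hWK : ∀ x, x ≠ p → |x - p| < δ → W x = k₀ / (x - p) ^ 2 + k₁ / (x - p) + K x)
    {b : ℝ} (hb : p < b) (hb' : b < p + δ) :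
    HasFinitePart P f p b (W b - K p + ∫ x in p..b, G x) := by
  refine ⟨fun ε hε => integrableOn_excised hf p b hε,
    -- This is the principal part of -W at x - p = ε, the lower boundary term.
    -(Polynomial.C k₀ * Polynomial.X ^ 2 + Polynomial.C k₁ * Polynomial.X), by simp, ?_⟩
  have hlim : Tendsto (fun ε : ℝ => W b - K (p + ε) + ∫ x in (p + ε)..b, G x) (𝓝[>] 0)
      (𝓝 (W b - K p + ∫ x in p..b, G x)) := by
    have h0 : Tendsto (fun ε : ℝ => p + ε) (𝓝[>] 0) (𝓝 p) := by
      have : Tendsto (fun ε : ℝ => p + ε) (𝓝 0) (𝓝 (p + 0)) :=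
        (continuous_const.add continuous_id).tendsto 0
      rw [add_zero] at this
      exact this.mono_left nhdsWithin_le_nhds
    have h1 : Continuous fun y => ∫ x in y..b, G x := by
      have : (fun y => ∫ x in y..b, G x) = fun y => -∫ x in b..y, G x := by
        funext y
        rw [intervalIntegral.integral_symm]
      rw [this]
      exact (intervalIntegral.continuous_primitive (fun _ _ => hG.intervalIntegrable _ _) b).neg
    exact ((tendsto_const_nhds).sub (hK.tendsto.comp h0)).add ((h1.tendsto p).comp h0)
  refine hlim.congr' ?_
  -- The bound by p + δ - b keeps the neighbourhoods of the other poles, at distance at least δ from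
  -- p, away from [p, b].
  filter_upwards [Ioo_mem_nhdsGT (lt_min (sub_pos.2 hb) (by linarith : 0 < p + δ - b))] with ε hε
  obtain ⟨hε0, hε1⟩ := hε
  have hε2 := hε1.trans_le (min_le_left _ _)
  have hε3 := hε1.trans_le (min_le_right _ _)
  have hE : excised P p b ε = Set.Icc (p + ε) b := by
    ext x
    constructor
    · rintro ⟨⟨h1, h2⟩, h3⟩
      have h4 := h3 p hp
      rw [abs_of_nonneg (sub_nonneg.2 h1)] at h4
      exact ⟨by linarith, h2⟩
    · rintro ⟨h1, h2⟩
      refine ⟨⟨by linarith, h2⟩, fun y hy => ?_⟩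
      by_cases hyp : y = p
      · rw [hyp]
        exact le_trans (by linarith) (le_abs_self _)
      · have h3 : δ ≤ |y - p| := not_lt.1 fun h => hyp (hP y hy h)
        rcases le_abs.1 h3 with h4 | h4
        · exact le_trans (by linarith) (neg_le_abs _)
        · exact le_trans (by linarith) (le_abs_self _)
  have hne : ∀ x ∈ Set.uIcc (p + ε) b, x ≠ p ∧ |x - p| < δ := by
    intro x hx
    rw [Set.uIcc_of_le (by linarith)] at hx
    refine ⟨by rintro rfl; linarith [hx.1], ?_⟩
    rw [abs_lt]
    constructor <;> linarith [hx.1, hx.2]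
  rw [hE, integral_Icc_eq_integral_Ioc, ← intervalIntegral.integral_of_le (by linarith),
    integral_eq_sub_add_integral (fun x hx => hf x fun h => (hne x hx).1 (hP x h (hne x hx).2)) hG
      fun x hx => hW x (hne x hx).1 (hne x hx).2]
  have h1 := hne (p + ε) Set.left_mem_uIcc
  rw [hWK _ h1.1 h1.2]
  simp only [Polynomial.eval_neg, Polynomial.eval_add, Polynomial.eval_mul, Polynomial.eval_C,
    Polynomial.eval_pow, Polynomial.eval_X, add_sub_cancel_left]
  field_simp
  ring

theorem hasFinitePart_of_right_pole (hf : ∀ x ∉ P, ContinuousAt f x) (hG : Continuous G)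
    (hp : p ∈ P) (hP : ∀ x ∈ P, |x - p| < δ → x = p)
    (hW : ∀ x, x ≠ p → |x - p| < δ → HasDerivAt W (f x - G x) x)
    (hK : ContinuousAt K p)
    (hWK : ∀ x, x ≠ p → |x - p| < δ → W x = k₀ / (x - p) ^ 2 + k₁ / (x - p) + K x)
    {a : ℝ} (ha : a < p) (ha' : p - δ < a) :
    HasFinitePart P f a p (K p - W a + ∫ x in a..p, G x) := by
  refine ⟨fun ε hε => integrableOn_excised hf a p hε,
    -- Here x - p = -ε, which changes the sign of the simple-pole term.
    Polynomial.C k₀ * Polynomial.X ^ 2 - Polynomial.C k₁ * Polynomial.X, by simp, ?_⟩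
  have hlim : Tendsto (fun ε : ℝ => K (p - ε) - W a + ∫ x in a..(p - ε), G x) (𝓝[>] 0)
      (𝓝 (K p - W a + ∫ x in a..p, G x)) := by
    have h0 : Tendsto (fun ε : ℝ => p - ε) (𝓝[>] 0) (𝓝 p) := by
      have : Tendsto (fun ε : ℝ => p - ε) (𝓝 0) (𝓝 (p - 0)) :=
        (continuous_const.sub continuous_id).tendsto 0
      rw [sub_zero] at this
      exact this.mono_left nhdsWithin_le_nhds
    have h1 : Continuous fun y => ∫ x in a..y, G x :=
      intervalIntegral.continuous_primitive (fun _ _ => hG.intervalIntegrable _ _) a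
    exact ((hK.tendsto.comp h0).sub tendsto_const_nhds).add ((h1.tendsto p).comp h0)
  refine hlim.congr' ?_
  filter_upwards [Ioo_mem_nhdsGT (lt_min (sub_pos.2 ha) (by linarith : 0 < a - (p - δ)))] with ε hε
  obtain ⟨hε0, hε1⟩ := hε
  have hε2 := hε1.trans_le (min_le_left _ _)
  have hε3 := hε1.trans_le (min_le_right _ _)
  have hE : excised P a p ε = Set.Icc a (p - ε) := by
    ext x
    constructor
    · rintro ⟨⟨h1, h2⟩, h3⟩
      have h4 := h3 p hp
      rw [abs_of_nonpos (sub_nonpos.2 h2)] at h4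
      exact ⟨h1, by linarith⟩
    · rintro ⟨h1, h2⟩
      refine ⟨⟨h1, by linarith⟩, fun y hy => ?_⟩
      by_cases hyp : y = p
      · rw [hyp]
        exact le_trans (by linarith) (neg_le_abs _)
      · have h3 : δ ≤ |y - p| := not_lt.1 fun h => hyp (hP y hy h)
        rcases le_abs.1 h3 with h4 | h4
        · exact le_trans (by linarith) (neg_le_abs _)
        · exact le_trans (by linarith) (le_abs_self _)
  have hne : ∀ x ∈ Set.uIcc a (p - ε), x ≠ p ∧ |x - p| < δ := by
    intro x hx
    rw [Set.uIcc_of_le (by linarith)] at hx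
    refine ⟨by rintro rfl; linarith [hx.2], ?_⟩
    rw [abs_lt]
    constructor <;> linarith [hx.1, hx.2]
  rw [hE, integral_Icc_eq_integral_Ioc, ← intervalIntegral.integral_of_le (by linarith),
    integral_eq_sub_add_integral (fun x hx => hf x fun h => (hne x hx).1 (hP x h (hne x hx).2)) hG
      fun x hx => hW x (hne x hx).1 (hne x hx).2]
  have h1 := hne (p - ε) Set.right_mem_uIcc
  rw [hWK _ h1.1 h1.2]
  simp only [Polynomial.eval_sub, Polynomial.eval_mul, Polynomial.eval_C,
    Polynomial.eval_pow, Polynomial.eval_X, sub_sub_cancel_left]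
  field_simp
  ring

end PoleAtEndpoint

/-- Gluing of finite parts: `W` is a primitive of `f - G` away from the closed discrete set `P`,
with poles of order at most two at the points of `P`, where the regular part takes the
value `V`. -/
theorem hasFinitePart_of_primitive {P : Set ℝ} {f G W V : ℝ → ℝ}
    (hf : ∀ x ∉ P, ContinuousAt f x) (hG : Continuous G) (hPc : IsClosed P)
    (hW : ∀ x ∉ P, HasDerivAt W (f x - G x) x) (hV : ∀ x ∉ P, V x = W x)
    (hpole : ∀ p ∈ P, ∃ (K : ℝ → ℝ) (k₀ k₁ : ℝ), ContinuousAt K p ∧ K p = V p ∧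
      ∀ᶠ x in 𝓝[≠] p, x ∉ P ∧ W x = k₀ / (x - p) ^ 2 + k₁ / (x - p) + K x)
    {a b : ℝ} (hab : a < b) :
    HasFinitePart P f a b (V b - V a + ∫ x in a..b, G x) := by
  have hpole' : ∀ p ∈ P, ∃ (K : ℝ → ℝ) (k₀ k₁ δ : ℝ), ContinuousAt K p ∧ K p = V p ∧ 0 < δ ∧
      ∀ x, x ≠ p → |x - p| < δ → x ∉ P ∧ W x = k₀ / (x - p) ^ 2 + k₁ / (x - p) + K x := by
    intro p hp
    obtain ⟨K, k₀, k₁, hK, hKV, h⟩ := hpole p hp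
    obtain ⟨δ, hδ, hb⟩ := Metric.eventually_nhds_iff.1 (eventually_nhdsWithin_iff.1 h)
    exact ⟨K, k₀, k₁, δ, hK, hKV, hδ, fun x hx hd => hb (by rwa [Real.dist_eq]) hx⟩
  have hreg : ∀ x ∉ P, ∃ δ > 0, ∀ y ∈ P, δ ≤ |y - x| := by
    intro x hx
    obtain ⟨δ, hδ, hb⟩ := Metric.eventually_nhds_iff.1 (hPc.isOpen_compl.mem_nhds hx)
    refine ⟨δ, hδ, fun y hy => not_lt.1 fun h => hb (by rwa [Real.dist_eq]) hy⟩
  have regular : ∀ c d δ, c < d → 0 < δ → (∀ y ∈ P, y ≤ c - δ ∨ d + δ ≤ y) →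
      HasFinitePart P f c d (V d - V c + ∫ x in c..d, G x) := by
    intro c d δ hcd hδ hP
    have hn : ∀ x ∈ Set.uIcc c d, x ∉ P := by
      intro x hx hxP
      rw [Set.uIcc_of_le hcd.le] at hx
      rcases hP x hxP with h | h <;> linarith [hx.1, hx.2]
    have h := hasFinitePart_of_no_poles hf hδ hcd.le hP
    rwa [integral_eq_sub_add_integral (fun x hx => hf x (hn x hx)) hG fun x hx => hW x (hn x hx),
      ← hV c (hn c Set.left_mem_uIcc), ← hV d (hn d Set.right_mem_uIcc)] at h
  -- Since V takes one value at each pole, shared by both sides, the boundary terms telescope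
  -- through poles as well.
  refine rel_of_local (r := fun a b => HasFinitePart P f a b (V b - V a + ∫ x in a..b, G x)) hab
    ?_ ?_ ?_
  · intro x y z hxy hyz h h'
    convert HasFinitePart.trans hxy.le hyz.le h h' using 1
    rw [← intervalIntegral.integral_add_adjacent_intervals (hG.intervalIntegrable x y)
      (hG.intervalIntegrable y z)]
    ring
  · intro x _
    by_cases hx : x ∈ P
    · obtain ⟨K, k₀, k₁, δ, hK, hKV, hδ, h⟩ := hpole' x hx
      filter_upwards [Ioo_mem_nhdsGT (lt_add_of_pos_right x hδ)] with y hy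
      have := hasFinitePart_of_left_pole hf hG hx
        (fun z hz hd => by_contra fun hne => (h z hne hd).1 hz)
        (fun z hne hd => hW z (h z hne hd).1) hK (fun z hne hd => (h z hne hd).2) hy.1 hy.2
      rwa [hKV, ← hV y] at this
      exact (h y hy.1.ne' (by rw [abs_lt]; constructor <;> linarith [hy.1, hy.2])).1
    · obtain ⟨δ, hδ, h⟩ := hreg x hx
      filter_upwards [Ioo_mem_nhdsGT (lt_add_of_pos_right x (half_pos hδ))] with y hy
      refine regular x y (δ / 2) hy.1 (half_pos hδ) fun z hz => ?_
      rcases le_abs.1 (h z hz) with h1 | h1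
      · right; linarith [hy.1, hy.2]
      · left; linarith [hy.1, hy.2]
  · intro x _
    by_cases hx : x ∈ P
    · obtain ⟨K, k₀, k₁, δ, hK, hKV, hδ, h⟩ := hpole' x hx
      filter_upwards [Ioo_mem_nhdsLT (sub_lt_self x hδ)] with y hy
      have := hasFinitePart_of_right_pole hf hG hx
        (fun z hz hd => by_contra fun hne => (h z hne hd).1 hz)
        (fun z hne hd => hW z (h z hne hd).1) hK (fun z hne hd => (h z hne hd).2) hy.2 hy.1
      rwa [hKV, ← hV y] at this
      exact (h y hy.2.ne (by rw [abs_lt]; constructor <;> linarith [hy.1, hy.2])).1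
    · obtain ⟨δ, hδ, h⟩ := hreg x hx
      filter_upwards [Ioo_mem_nhdsLT (sub_lt_self x (half_pos hδ))] with y hy
      refine regular y x (δ / 2) hy.2 (half_pos hδ) fun z hz => ?_
      rcases le_abs.1 (h z hz) with h1 | h1
      · right; linarith [hy.1, hy.2]
      · left; linarith [hy.1, hy.2]

/-- Without poles inside the interval and with a bounded integrand, the finite part is the
ordinary integral. -/
theorem HasFinitePart.integral_eq {P : Set ℝ} {f : ℝ → ℝ} {a b l : ℝ} (hab : a ≤ b)
    (hP : ∀ x ∈ Set.Ioo a b, x ∉ P) (hPc : IsClosed P) (hfi : IntervalIntegrable f volume a b)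
    (h : HasFinitePart P f a b l) : ∫ x in a..b, f x = l := by
  refine finitePart_unique (P := P) (f := f) (a := a) (b := b) ⟨h.1, 0, by simp, ?_⟩ h
  have hI : IntegrableOn f (Set.Ioo a b) :=
    (((intervalIntegrable_iff_integrableOn_Ioc_of_le hab).1 hfi)).mono_set Set.Ioo_subset_Ioc_self
  rw [intervalIntegral.integral_of_le hab, integral_Ioc_eq_integral_Ioo]
  -- Dominated convergence: P is closed, so an interior point lies in the excised set once ε is
  -- below its distance to P.
  have key : Tendsto (fun ε : ℝ => ∫ x in Set.Ioo a b, (excised P a b ε).indicator f x) (𝓝[>] 0)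
      (𝓝 (∫ x in Set.Ioo a b, f x)) := by
    refine tendsto_integral_filter_of_dominated_convergence (fun x => ‖f x‖) ?_ ?_ hI.norm ?_
    · exact Eventually.of_forall fun ε =>
        hI.aestronglyMeasurable.indicator (isCompact_excised P a b ε).measurableSet
    · exact Eventually.of_forall fun ε => Eventually.of_forall fun x =>
        norm_indicator_le_norm_self _ _
    · refine (ae_restrict_iff' measurableSet_Ioo).2 (Eventually.of_forall fun x hx => ?_)
      obtain ⟨δ, hδ, hb⟩ := Metric.eventually_nhds_iff.1 (hPc.isOpen_compl.mem_nhds (hP x hx))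
      refine tendsto_const_nhds.congr' ?_
      filter_upwards [Ioo_mem_nhdsGT hδ] with ε hε
      rw [Set.indicator_of_mem]
      refine ⟨⟨hx.1.le, hx.2.le⟩, fun p hp => not_lt.1 fun hlt => hb (y := p) ?_ hp⟩
      rw [Real.dist_eq, abs_sub_comm]
      exact hlt.trans hε.2
  refine key.congr fun ε => ?_
  rw [setIntegral_indicator (isCompact_excised P a b ε).measurableSet]
  simp only [Polynomial.eval_zero, sub_zero]
  refine setIntegral_congr_set ?_
  have h1 : (Set.Ioo a b ∩ excised P a b ε : Set ℝ) =ᵐ[volume]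
      (Set.Icc a b ∩ excised P a b ε : Set ℝ) :=
    Ioo_ae_eq_Icc.inter (ae_eq_refl _)
  refine h1.trans (Eventually.of_forall fun x => ?_)
  rw [Set.inter_eq_self_of_subset_right fun x hx => hx.1]

/-! ### Affine charts along an immersed curve -/

theorem contDiffAt_deriv_infty {f : ℝ → ℝ} {x : ℝ} (h : ContDiffAt ℝ ∞ f x) :
    ContDiffAt ℝ ∞ (deriv f) x :=
  contDiffAt_infty.2 fun n => contDiffAt_deriv (contDiffAt_infty.1 h (n + 1))

theorem hasDerivAt_of_contDiffAt {f : ℝ → ℝ} {x : ℝ} (hf : ContDiffAt ℝ ∞ f x) :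
    HasDerivAt f (deriv f x) x :=
  (hf.differentiableAt (by simp)).hasDerivAt

theorem coe_coord {z : RP1} (h : z ≠ OnePoint.infty) : ((coord z : ℝ) : RP1) = z := by
  induction z using OnePoint.rec with
  | infty => exact absurd rfl h
  | coe r => rfl

/-- A change of affine chart, as a Möbius transformation of the coordinate. -/
theorem chart_change {φ : ℝ → RP1} {f : ℝ → ℝ} {x : ℝ} {h : GL (Fin 2) ℝ}
    (e : ∀ᶠ y in 𝓝 x, h • φ y = ((f y : ℝ) : RP1)) (hf : ContDiffAt ℝ ∞ f x)
    (g : GL (Fin 2) ℝ) (hg : g • φ x ≠ OnePoint.infty) :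
    ∃ B : GL (Fin 2) ℝ, B = g * h⁻¹ ∧ B 1 0 * f x + B 1 1 ≠ 0 ∧
      ∀ᶠ y in 𝓝 x, B 1 0 * f y + B 1 1 ≠ 0 ∧
        g • φ y = (((B 0 0 * f y + B 0 1) / (B 1 0 * f y + B 1 1) : ℝ) : RP1) := by
  have e' : ∀ᶠ y in 𝓝 x, g • φ y = (g * h⁻¹) • ((f y : ℝ) : RP1) := by
    filter_upwards [e] with y hy
    rw [← hy, mul_smul, inv_smul_smul]
  have hne : (g * h⁻¹) 1 0 * f x + (g * h⁻¹) 1 1 ≠ 0 := by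
    intro h0
    exact hg (by rw [e'.self_of_nhds, OnePoint.smul_some_eq_ite, if_pos h0])
  refine ⟨_, rfl, hne, ?_⟩
  have hcont : ContinuousAt (fun y => (g * h⁻¹) 1 0 * f y + (g * h⁻¹) 1 1) x := by
    have := hf.continuousAt
    fun_prop
  filter_upwards [e', hcont.eventually_ne hne] with y hy hy'
  exact ⟨hy', by rw [hy, OnePoint.smul_some_eq_ite, if_neg hy']⟩

theorem GL_det_ne_zero (B : GL (Fin 2) ℝ) : B 0 0 * B 1 1 - B 0 1 * B 1 0 ≠ 0 := by
  have := B.det_ne_zero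
  rwa [Matrix.det_fin_two] at this

/-- Passes from the one chart supplied by `IsImmersion` to every chart finite at x: the transition
is a homography, with nonvanishing derivative det / (ct + d)². -/
theorem chart_spec {φ : ℝ → RP1} (hφ : IsImmersion φ) (g : GL (Fin 2) ℝ) {x : ℝ}
    (hg : g • φ x ≠ OnePoint.infty) :
    ContDiffAt ℝ ∞ (fun y => coord (g • φ y)) x ∧ deriv (fun y => coord (g • φ y)) x ≠ 0 ∧
      ∀ᶠ y in 𝓝 x, g • φ y ≠ OnePoint.infty := by
  obtain ⟨h, f, hf, hd, e⟩ := hφ x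
  obtain ⟨B, -, hne, hB⟩ := chart_change e hf g hg
  have heq : (fun y => coord (g • φ y)) =ᶠ[𝓝 x]
      fun y => (B 0 0 * f y + B 0 1) / (B 1 0 * f y + B 1 1) := by
    filter_upwards [hB] with y hy
    rw [hy.2]
    rfl
  refine ⟨?_, ?_, ?_⟩
  · refine ContDiffAt.congr_of_eventuallyEq ?_ heq
    exact ((contDiffAt_const.mul hf).add contDiffAt_const).div
      ((contDiffAt_const.mul hf).add contDiffAt_const) hne
  · have D := hasDerivAt_of_contDiffAt hf
    have := ((D.const_mul (B 0 0)).add_const (B 0 1)).div ((D.const_mul (B 1 0)).add_const (B 1 1))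
      hne
    rw [heq.deriv_eq]
    refine ne_of_eq_of_ne this.deriv (div_ne_zero ?_ (pow_ne_zero 2 hne))
    have h1 : B 0 0 * deriv f x * (B 1 0 * f x + B 1 1) -
        (B 0 0 * f x + B 0 1) * (B 1 0 * deriv f x) =
        (B 0 0 * B 1 1 - B 0 1 * B 1 0) * deriv f x := by ring
    rw [h1]
    exact mul_ne_zero (GL_det_ne_zero B) hd
  · filter_upwards [hB] with y hy
    rw [hy.2]
    exact OnePoint.coe_ne_infty _

theorem eventually_contDiffAt_chart {φ : ℝ → RP1} (hφ : IsImmersion φ) (g : GL (Fin 2) ℝ) {x : ℝ}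
    (hg : g • φ x ≠ OnePoint.infty) :
    ∀ᶠ y in 𝓝 x, ContDiffAt ℝ ∞ (fun y => coord (g • φ y)) y := by
  filter_upwards [(chart_spec hφ g hg).2.2] with y hy
  exact (chart_spec hφ g hy).1

theorem isClosed_poles (g : GL (Fin 2) ℝ) (φ : DevMap) : IsClosed (poles g φ) := by
  rw [← isOpen_compl_iff, isOpen_iff_mem_nhds]
  exact fun x hx => (chart_spec φ.immersion g hx).2.2

theorem exists_chart {φ : ℝ → RP1} (hφ : IsImmersion φ) (x : ℝ) :
    ∃ g : GL (Fin 2) ℝ, g • φ x ≠ OnePoint.infty := by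
  obtain ⟨g, f, -, -, e⟩ := hφ x
  exact ⟨g, by rw [e.self_of_nhds]; exact OnePoint.coe_ne_infty _⟩

theorem schwarz_eq_chart {φ : ℝ → RP1} (hφ : IsImmersion φ) (g : GL (Fin 2) ℝ) {x : ℝ}
    (hg : g • φ x ≠ OnePoint.infty) :
    schwarz φ x = schwarzReal (fun y => coord (g • φ y)) x := by
  obtain ⟨h1, h2, h3⟩ := chart_spec hφ g hg
  refine schwarz_eq_local h1 h2 g ?_
  filter_upwards [h3] with y hy
  exact (coe_coord hy).symm

theorem contDiff_schwarz {φ : ℝ → RP1} (hφ : IsImmersion φ) : ContDiff ℝ ∞ (schwarz φ) := by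
  refine contDiff_iff_contDiffAt.2 fun x => ?_
  obtain ⟨g, hg⟩ := exists_chart hφ x
  obtain ⟨h1, h2, h3⟩ := chart_spec hφ g hg
  have heq : schwarz φ =ᶠ[𝓝 x] schwarzReal fun y => coord (g • φ y) := by
    filter_upwards [h3] with y hy
    exact schwarz_eq_chart hφ g hy
  refine ContDiffAt.congr_of_eventuallyEq ?_ heq
  have h4 := contDiffAt_deriv_infty h1
  have h5 := contDiffAt_deriv_infty h4
  have h6 := contDiffAt_deriv_infty h5
  exact (h6.div h4 h2).sub (contDiffAt_const.mul ((h5.div h4 h2).pow 2))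

theorem schwarzReal_shift (f : ℝ → ℝ) (c x : ℝ) :
    schwarzReal (fun y => f (y + c)) x = schwarzReal f (x + c) := by
  have h (f : ℝ → ℝ) : deriv (fun y => f (y + c)) = fun y => deriv f (y + c) :=
    funext fun y => deriv_comp_add_const f c y
  unfold schwarzReal
  simp only [h]

theorem schwarz_shift (φ : ℝ → RP1) (c x : ℝ) :
    schwarz (fun y => φ (y + c)) x = schwarz φ (x + c) := by
  unfold schwarz
  rw [← schwarzReal_shift, ← schwarzReal_shift]

/-- Translation by a period composes the curve with its monodromy, and the Schwarzian does not see
homographies. -/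
theorem periodic_schwarz (φ : DevMap) : Function.Periodic (schwarz φ.toFun) (2 * Real.pi) := by
  intro x
  obtain ⟨T, hT⟩ := φ.equivariant
  rw [← schwarz_shift, ← congrFun (schwarz_smul φ.immersion T) x]
  congr 1
  exact funext hT

/-! ### The logarithmic derivative of the 1-form -/

/-- The logarithmic derivative `θ' / θ` of the 1-form attached to an affine parameter. -/
def logDer (g : GL (Fin 2) ℝ) (φ : DevMap) (x : ℝ) : ℝ :=
  deriv (pullForm g φ) x / pullForm g φ x

section LogDer

variable {g : GL (Fin 2) ℝ} {φ : DevMap} {x : ℝ}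

theorem pullForm_ne_zero (hx : x ∉ poles g φ) : pullForm g φ x ≠ 0 :=
  (chart_spec φ.immersion g hx).2.1

theorem contDiffAt_pullForm (hx : x ∉ poles g φ) : ContDiffAt ℝ ∞ (pullForm g φ) x :=
  contDiffAt_deriv_infty (chart_spec φ.immersion g hx).1

/-- The Riccati form of the Schwarzian, S = ρ' - ρ²/2 with ρ = θ'/θ. Every later elimination of
derivatives of θ goes through it. -/
theorem hasDerivAt_logDer (hx : x ∉ poles g φ) :
    HasDerivAt (logDer g φ) (schwarz φ.toFun x + logDer g φ x ^ 2 / 2) x := by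
  have h1 := contDiffAt_pullForm hx
  have h0 := pullForm_ne_zero hx
  have := (hasDerivAt_of_contDiffAt (contDiffAt_deriv_infty h1)).div (hasDerivAt_of_contDiffAt h1)
    h0
  refine this.congr_deriv ?_
  rw [schwarz_eq_chart φ.immersion g hx]
  simp only [schwarzReal, logDer]
  change _ = deriv (deriv (pullForm g φ)) x / pullForm g φ x
    - 3 / 2 * (deriv (pullForm g φ) x / pullForm g φ x) ^ 2 + _
  field_simp
  ring

theorem lieForm_div (ξ : ℝ → ℝ) (hx : x ∉ poles g φ) :
    lieForm ξ (pullForm g φ) x / pullForm g φ x = ξ x * logDer g φ x + deriv ξ x := by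
  have h0 := pullForm_ne_zero hx
  unfold lieForm logDer
  field_simp

theorem density_eq (ξ₁ : ℝ → ℝ) {ξ₂ : ℝ → ℝ} (h₂ : ContDiff ℝ ∞ ξ₂) (hx : x ∉ poles g φ) :
    density (pullForm g φ) ξ₁ ξ₂ x = (ξ₁ x * logDer g φ x + deriv ξ₁ x) *
      (deriv ξ₂ x * logDer g φ x + ξ₂ x * (schwarz φ.toFun x + logDer g φ x ^ 2 / 2) +
        deriv (deriv ξ₂) x) := by
  have heq : (fun y => lieForm ξ₂ (pullForm g φ) y / pullForm g φ y) =ᶠ[𝓝 x]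
      fun y => ξ₂ y * logDer g φ y + deriv ξ₂ y := by
    filter_upwards [(isClosed_poles g φ).isOpen_compl.mem_nhds hx] with y hy
    exact lieForm_div ξ₂ hy
  have := ((hasDerivAt_of_contDiff h₂ x).mul (hasDerivAt_logDer hx)).add
    (hasDerivAt_of_contDiff (contDiff_deriv h₂) x)
  unfold density
  rw [lieForm_div ξ₁ hx, heq.deriv_eq]
  congr 1
  exact this.deriv

theorem continuousAt_density {ξ₁ ξ₂ : ℝ → ℝ} (h₁ : ContDiff ℝ ∞ ξ₁) (h₂ : ContDiff ℝ ∞ ξ₂)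
    (hx : x ∉ poles g φ) : ContinuousAt (density (pullForm g φ) ξ₁ ξ₂) x := by
  have heq : density (pullForm g φ) ξ₁ ξ₂ =ᶠ[𝓝 x] fun x => (ξ₁ x * logDer g φ x + deriv ξ₁ x) *
      (deriv ξ₂ x * logDer g φ x + ξ₂ x * (schwarz φ.toFun x + logDer g φ x ^ 2 / 2) +
        deriv (deriv ξ₂) x) := by
    filter_upwards [(isClosed_poles g φ).isOpen_compl.mem_nhds hx] with y hy
    exact density_eq ξ₁ h₂ hy
  refine ContinuousAt.congr ?_ heq.symm
  have c0 := (hasDerivAt_logDer hx).continuousAt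
  have c1 := (contDiff_schwarz φ.immersion).continuous.continuousAt (x := x)
  have c2 := h₁.continuous.continuousAt (x := x)
  have c3 := h₂.continuous.continuousAt (x := x)
  have c4 := (contDiff_deriv h₁).continuous.continuousAt (x := x)
  have c5 := (contDiff_deriv h₂).continuous.continuousAt (x := x)
  have c6 := (contDiff_deriv (contDiff_deriv h₂)).continuous.continuousAt (x := x)
  fun_prop

/-- The density of the 2-form, in terms of the Schwarzian derivative. -/
def baseDensity (q ξ₁ ξ₂ : ℝ → ℝ) (x : ℝ) : ℝ :=
  -(q x * (ξ₁ x * deriv ξ₂ x - deriv ξ₁ x * ξ₂ x)) + deriv ξ₁ x * deriv (deriv ξ₂) x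

/-- The potential that relates the two densities. -/
def potential (ρ ξ₁ ξ₂ : ℝ → ℝ) (x : ℝ) : ℝ :=
  ρ x * (ξ₁ x * deriv ξ₂ x) + ρ x ^ 2 / 2 * (ξ₁ x * ξ₂ x)

/-- Once ρ' is eliminated by the Riccati equation, all terms of the density that contain ρ are
absorbed in an exact derivative. What remains involves only the Schwarzian and the fields. -/
theorem hasDerivAt_potential {ξ₁ ξ₂ : ℝ → ℝ} (h₁ : ContDiff ℝ ∞ ξ₁) (h₂ : ContDiff ℝ ∞ ξ₂)
    (hx : x ∉ poles g φ) :
    HasDerivAt (potential (logDer g φ) ξ₁ ξ₂)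
      (density (pullForm g φ) ξ₁ ξ₂ x - baseDensity (schwarz φ.toFun) ξ₁ ξ₂ x) x := by
  have d0 := hasDerivAt_logDer hx
  have d1 := hasDerivAt_of_contDiff h₁ x
  have d2 := hasDerivAt_of_contDiff h₂ x
  have d3 := hasDerivAt_of_contDiff (contDiff_deriv h₂) x
  have := (d0.mul (d1.mul d3)).add (((d0.pow 2).div_const 2).mul (d1.mul d2))
  refine this.congr_deriv ?_
  rw [density_eq ξ₁ h₂ hx]
  simp only [baseDensity, Pi.mul_apply, Pi.pow_apply]
  ring

/-- Also true at 0 and ∞, by the conventions that the coordinate of ∞ is 0 and 0⁻¹ = 0. -/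
theorem coord_eq_inv (z : RP1) : coord z = (coord (invGL • z))⁻¹ := by
  induction z using OnePoint.rec with
  | infty =>
    rw [OnePoint.smul_infty_eq_ite]
    simp [invGL, Matrix.GeneralLinearGroup.mkOfDetNeZero, coord]
  | coe r =>
    rw [OnePoint.smul_some_eq_ite]
    by_cases hr : r = 0
    · simp [invGL, Matrix.GeneralLinearGroup.mkOfDetNeZero, coord, hr]
    · simp [invGL, Matrix.GeneralLinearGroup.mkOfDetNeZero, coord, hr]

theorem invGL_smul_infty : invGL • (OnePoint.infty : RP1) = ((0 : ℝ) : RP1) := by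
  rw [OnePoint.smul_infty_eq_ite]
  simp [invGL, Matrix.GeneralLinearGroup.mkOfDetNeZero]

theorem logDer_of_eq_inv {S : ℝ → ℝ} (hS : ContDiff ℝ ∞ S) (hx : S x ≠ 0) (hx' : deriv S x ≠ 0)
    (h : (fun y => coord (g • φ.toFun y)) =ᶠ[𝓝 x] fun y => (S y)⁻¹) :
    logDer g φ x = deriv (deriv S) x / deriv S x - 2 * deriv S x / S x := by
  have D0 := hasDerivAt_of_contDiff hS
  have D1 := hasDerivAt_of_contDiff (contDiff_deriv hS)
  have e1 : pullForm g φ =ᶠ[𝓝 x] fun y => -deriv S y / S y ^ 2 := by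
    refine h.deriv.trans ?_
    filter_upwards [hS.continuous.continuousAt.eventually_ne hx] with y hy
    exact ((D0 y).inv hy).deriv
  unfold logDer
  have e2 : deriv (fun y => -deriv S y / S y ^ 2) x = _ :=
    ((D1 x).neg.div ((D0 x).pow 2) (pow_ne_zero 2 hx)).deriv
  rw [e1.deriv_eq, e1.eq_of_nhds, e2]
  simp only [Pi.neg_apply, Pi.pow_apply]
  field_simp
  ring

/-- At a pole, the logarithmic derivative has a simple pole with residue `-2`. -/
theorem logDer_at_pole {p : ℝ} (hp : p ∈ poles g φ) :
    ∃ M : ℝ → ℝ, ContDiff ℝ ∞ M ∧ M p = -2 ∧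
      ∀ᶠ y in 𝓝[≠] p, y ∉ poles g φ ∧ logDer g φ y = M y / (y - p) := by
  have hp' : g • φ.toFun p = OnePoint.infty := hp
  have hg : (invGL * g) • φ.toFun p ≠ OnePoint.infty := by
    rw [mul_smul, hp', invGL_smul_infty]
    exact OnePoint.coe_ne_infty _
  obtain ⟨S, hS, hSeq⟩ :=
    exists_contDiff_eventuallyEq (eventually_contDiffAt_chart φ.immersion _ hg)
  have hSp : S p = 0 := by
    rw [hSeq.eq_of_nhds, mul_smul, hp', invGL_smul_infty]
    rfl
  have hS'p : deriv S p ≠ 0 := by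
    rw [hSeq.deriv_eq]
    exact (chart_spec φ.immersion _ hg).2.1
  obtain ⟨R, hR, hRp, hSR⟩ := exists_smooth_quotient hS p
  simp only [hSp, zero_add] at hSR
  have hRp' : R p ≠ 0 := by rwa [hRp]
  have eR := hR.continuous.continuousAt.eventually_ne hRp'
  have eS' := (contDiff_deriv hS).continuous.continuousAt.eventually_ne hS'p
  -- With t = 1/S and S = (y - p)R, ρ = S''/S' - 2S'/S; multiplying by y - p gives this function.
  -- Its value at p is -2 since R(p) = S'(p).
  have hm : ∀ᶠ y in 𝓝 p, ContDiffAt ℝ ∞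
      (fun y => (y - p) * deriv (deriv S) y / deriv S y - 2 * deriv S y / R y) y := by
    filter_upwards [eR, eS'] with y hy hy'
    have c0 := (contDiff_deriv hS).contDiffAt (x := y)
    have c1 := (contDiff_deriv (contDiff_deriv hS)).contDiffAt (x := y)
    exact (((contDiffAt_id.sub contDiffAt_const).mul c1).div c0 hy').sub
      ((contDiffAt_const.mul c0).div hR.contDiffAt hy)
  obtain ⟨M, hM, hMeq⟩ := exists_contDiff_eventuallyEq hm
  refine ⟨M, hM, ?_, ?_⟩
  · rw [hMeq.eq_of_nhds, hRp]
    field_simp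
    ring
  · have e := (hMeq.and (eR.and (eS'.and hSeq.eventually_nhds)))
    filter_upwards [self_mem_nhdsWithin, e.filter_mono nhdsWithin_le_nhds] with y hy hy'
    obtain ⟨h1, h2, h3, h4⟩ := hy'
    have hyp : y - p ≠ 0 := sub_ne_zero.2 hy
    have hSy : S y ≠ 0 := by
      rw [hSR]
      exact mul_ne_zero hyp h2
    refine ⟨fun hpole => hSy ?_, ?_⟩
    · have hpole' : g • φ.toFun y = OnePoint.infty := hpole
      rw [h4.self_of_nhds, mul_smul, hpole', invGL_smul_infty]
      rfl
    · rw [logDer_of_eq_inv hS hSy h3, h1, hSR y]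
      · field_simp
      · filter_upwards [h4] with z hz
        rw [hz, mul_smul, ← coord_eq_inv]

/-- The expansion of the potential at a pole. -/
theorem potential_at_pole {p : ℝ} (hp : p ∈ poles g φ) {ξ₁ ξ₂ : ℝ → ℝ} (h₁ : ContDiff ℝ ∞ ξ₁)
    (h₂ : ContDiff ℝ ∞ ξ₂) :
    ∃ (K : ℝ → ℝ) (k₀ k₁ : ℝ), ContDiff ℝ ∞ K ∧
      (ξ₁ p = 0 → ξ₂ p = 0 → k₀ = 0 ∧ k₁ = 0 ∧ K p = 0) ∧
      ∀ᶠ x in 𝓝[≠] p, x ∉ poles g φ ∧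
        potential (logDer g φ) ξ₁ ξ₂ x = k₀ / (x - p) ^ 2 + k₁ / (x - p) + K x := by
  obtain ⟨M, hM, hMp, hMe⟩ := logDer_at_pole hp
  have hd₂ := contDiff_deriv h₂
  -- If both fields vanish, their zeros cancel the double pole, and the remaining value at p is (M +
  -- M²/2)ξ₁'ξ₂', which is 0 exactly because M(p) = -2. Otherwise (x - p)²W is smooth and is
  -- expanded to second order.
  by_cases h : ξ₁ p = 0 ∧ ξ₂ p = 0
  · obtain ⟨η₁, c₁, -, e₁⟩ := exists_smooth_quotient h₁ p
    obtain ⟨η₂, c₂, v₂, e₂⟩ := exists_smooth_quotient h₂ p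
    simp only [h.1, zero_add] at e₁
    simp only [h.2, zero_add] at e₂
    refine ⟨fun x => M x * (η₁ x * deriv ξ₂ x) + M x ^ 2 / 2 * (η₁ x * η₂ x), 0, 0,
      by fun_prop, fun _ _ => ⟨rfl, rfl, ?_⟩, ?_⟩
    · simp only [hMp, v₂]
      ring
    · filter_upwards [hMe, self_mem_nhdsWithin] with x hx hx'
      have hxp : x - p ≠ 0 := sub_ne_zero.2 hx'
      refine ⟨hx.1, ?_⟩
      simp only [potential]
      rw [hx.2, e₁ x, e₂ x]
      field_simp
      ring
  · obtain ⟨k, hk, -, ek⟩ := exists_smooth_quotient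
      (f := fun x => M x * (x - p) * (ξ₁ x * deriv ξ₂ x) + M x ^ 2 / 2 * (ξ₁ x * ξ₂ x))
      (by fun_prop) p
    obtain ⟨K, hK, -, eK⟩ := exists_smooth_quotient hk p
    generalize M p * (p - p) * (ξ₁ p * deriv ξ₂ p) + M p ^ 2 / 2 * (ξ₁ p * ξ₂ p) = k₀ at ek
    refine ⟨K, k₀, k p, hK, fun a b => absurd ⟨a, b⟩ h, ?_⟩
    filter_upwards [hMe, self_mem_nhdsWithin] with x hx hx'
    have hxp : x - p ≠ 0 := sub_ne_zero.2 hx'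
    refine ⟨hx.1, ?_⟩
    have := ek x
    rw [eK x] at this
    have h3 : potential (logDer g φ) ξ₁ ξ₂ x =
        (M x * (x - p) * (ξ₁ x * deriv ξ₂ x) + M x ^ 2 / 2 * (ξ₁ x * ξ₂ x)) / (x - p) ^ 2 := by
      simp only [potential]
      rw [hx.2]
      field_simp
    rw [h3, this]
    field_simp
    ring

theorem continuous_baseDensity {q ξ₁ ξ₂ : ℝ → ℝ} (hq : Continuous q) (h₁ : ContDiff ℝ ∞ ξ₁)
    (h₂ : ContDiff ℝ ∞ ξ₂) : Continuous (baseDensity q ξ₁ ξ₂) := by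
  have c0 := h₁.continuous
  have c1 := h₂.continuous
  have c2 := (contDiff_deriv h₁).continuous
  have c3 := (contDiff_deriv h₂).continuous
  have c4 := (contDiff_deriv (contDiff_deriv h₂)).continuous
  unfold baseDensity
  fun_prop

/-- The finite part of the integral between two points where the vector fields vanish. -/
theorem hasFinitePart_density {ξ₁ ξ₂ : ℝ → ℝ} (h₁ : ContDiff ℝ ∞ ξ₁) (h₂ : ContDiff ℝ ∞ ξ₂)
    {a b : ℝ} (hab : a < b) (ha : ξ₁ a = 0 ∧ ξ₂ a = 0) (hb : ξ₁ b = 0 ∧ ξ₂ b = 0) :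
    HasFinitePart (poles g φ) (density (pullForm g φ) ξ₁ ξ₂) a b
      (∫ x in a..b, baseDensity (schwarz φ.toFun) ξ₁ ξ₂ x) := by
  -- V is the potential off the poles and its regular value at them; in both cases it is 0 at a
  -- common zero, which kills the terms at a and b.
  have hV : ∀ p, ∃ v : ℝ, (p ∉ poles g φ → v = potential (logDer g φ) ξ₁ ξ₂ p) ∧
      (ξ₁ p = 0 ∧ ξ₂ p = 0 → v = 0) ∧
      (p ∈ poles g φ → ∃ (K : ℝ → ℝ) (k₀ k₁ : ℝ), ContinuousAt K p ∧ K p = v ∧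
        ∀ᶠ x in 𝓝[≠] p, x ∉ poles g φ ∧
          potential (logDer g φ) ξ₁ ξ₂ x = k₀ / (x - p) ^ 2 + k₁ / (x - p) + K x) := by
    intro p
    by_cases hp : p ∈ poles g φ
    · obtain ⟨K, k₀, k₁, hK, h0, he⟩ := potential_at_pole hp h₁ h₂
      exact ⟨K p, fun h => absurd hp h, fun h => (h0 h.1 h.2).2.2,
        fun _ => ⟨K, k₀, k₁, hK.continuous.continuousAt, rfl, he⟩⟩
    · refine ⟨_, fun _ => rfl, fun h => ?_, fun h => absurd h hp⟩
      simp [potential, h.1, h.2]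
  choose V hV1 hV2 hV3 using hV
  have := hasFinitePart_of_primitive (P := poles g φ) (V := V)
    (fun x hx => continuousAt_density h₁ h₂ hx)
    (continuous_baseDensity (contDiff_schwarz φ.immersion).continuous h₁ h₂)
    (isClosed_poles g φ) (fun x hx => hasDerivAt_potential h₁ h₂ hx) hV1 hV3 hab
  rwa [hV2 a ha, hV2 b hb, sub_zero, zero_add] at this

/-- The potential has no principal part there, so it agrees off p with a smooth K, and the density
is K' plus the smooth density. -/
theorem density_near_common_zero {p : ℝ} (hp : p ∈ poles g φ) {ξ₁ ξ₂ : ℝ → ℝ}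
    (h₁ : ContDiff ℝ ∞ ξ₁) (h₂ : ContDiff ℝ ∞ ξ₂) (hz : ξ₁ p = 0 ∧ ξ₂ p = 0) :
    ∃ F : ℝ → ℝ, Continuous F ∧ ∀ᶠ x in 𝓝[≠] p, density (pullForm g φ) ξ₁ ξ₂ x = F x := by
  obtain ⟨K, k₀, k₁, hK, h0, he⟩ := potential_at_pole hp h₁ h₂
  obtain ⟨rfl, rfl, -⟩ := h0 hz.1 hz.2
  refine ⟨fun x => deriv K x + baseDensity (schwarz φ.toFun) ξ₁ ξ₂ x,
    (contDiff_deriv hK).continuous.add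
      (continuous_baseDensity (contDiff_schwarz φ.immersion).continuous h₁ h₂), ?_⟩
  have he' := eventually_eventually_nhdsWithin.2 he
  filter_upwards [he, he', self_mem_nhdsWithin] with x hx hx' hxp
  have h3 : potential (logDer g φ) ξ₁ ξ₂ =ᶠ[𝓝 x] K := by
    rw [IsOpen.nhdsWithin_eq isOpen_compl_singleton hxp] at hx'
    filter_upwards [hx'] with y hy
    rw [hy.2]
    simp
  rw [← h3.deriv_eq, (hasDerivAt_potential h₁ h₂ hx.1).deriv]
  ring

/-- Near each point the density agrees, off that point, with a function continuous there, so it is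
integrable locally; `rel_of_local` patches. Used when the only possible poles are the ends of the
period. -/
theorem intervalIntegrable_density {ξ₁ ξ₂ : ℝ → ℝ} (h₁ : ContDiff ℝ ∞ ξ₁) (h₂ : ContDiff ℝ ∞ ξ₂)
    {a b : ℝ} (hab : a < b)
    (hz : ∀ x ∈ Set.Icc a b, x ∈ poles g φ → ξ₁ x = 0 ∧ ξ₂ x = 0) :
    IntervalIntegrable (density (pullForm g φ) ξ₁ ξ₂) volume a b := by
  have local_int : ∀ x ∈ Set.Icc a b, ∃ F : ℝ → ℝ, ∃ δ > 0, ∀ y, y ≠ x → |y - x| < δ →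
      density (pullForm g φ) ξ₁ ξ₂ y = F y ∧ ContinuousAt F y ∧ ContinuousAt F x := by
    intro x hx
    by_cases hp : x ∈ poles g φ
    · obtain ⟨F, hF, he⟩ := density_near_common_zero hp h₁ h₂ (hz x hx hp)
      obtain ⟨δ, hδ, hb⟩ := Metric.eventually_nhds_iff.1 (eventually_nhdsWithin_iff.1 he)
      exact ⟨F, δ, hδ, fun y hy hd => ⟨hb (by rwa [Real.dist_eq]) hy, hF.continuousAt,
        hF.continuousAt⟩⟩
    · obtain ⟨δ, hδ, hb⟩ := Metric.eventually_nhds_iff.1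
        ((isClosed_poles g φ).isOpen_compl.mem_nhds hp)
      exact ⟨_, δ, hδ, fun y hy hd => ⟨rfl, continuousAt_density h₁ h₂
        (hb (by rwa [Real.dist_eq])), continuousAt_density h₁ h₂ hp⟩⟩
  have key : ∀ x ∈ Set.Icc a b, ∃ δ > 0, ∀ y, y ≠ x → |y - x| < δ →
      IntervalIntegrable (density (pullForm g φ) ξ₁ ξ₂) volume x y := by
    intro x hx
    obtain ⟨F, δ, hδ, h⟩ := local_int x hx
    refine ⟨δ, hδ, fun y hy hd => ?_⟩
    have hb : ∀ z ∈ Set.uIcc x y, |z - x| < δ := fun z hz =>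
      (Set.abs_sub_left_of_mem_uIcc hz).trans_lt hd
    have hFi : IntervalIntegrable F volume x y := by
      refine ContinuousOn.intervalIntegrable fun z hz => ContinuousAt.continuousWithinAt ?_
      by_cases hzx : z = x
      · rw [hzx]
        exact (h y hy hd).2.2
      · exact (h z hzx (hb z hz)).2.1
    refine hFi.congr_ae ?_
    refine (ae_restrict_iff' measurableSet_uIoc).2 ?_
    have hne : ∀ᵐ z : ℝ, z ≠ x := by simp [ae_iff]
    filter_upwards [hne] with z hzx hz'
    exact (h z hzx (hb z (Set.uIoc_subset_uIcc hz'))).1.symm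
  refine rel_of_local (r := fun a b => IntervalIntegrable (density (pullForm g φ) ξ₁ ξ₂) volume a b)
    hab (fun x y z _ _ h h' => h.trans h') ?_ ?_
  · intro x hx
    obtain ⟨δ, hδ, h⟩ := key x ⟨hx.1, hx.2.le⟩
    filter_upwards [Ioo_mem_nhdsGT (lt_add_of_pos_right x hδ)] with y hy
    exact h y hy.1.ne' (by rw [abs_lt]; constructor <;> linarith [hy.1, hy.2])
  · intro x hx
    obtain ⟨δ, hδ, h⟩ := key x ⟨hx.1.le, hx.2⟩
    filter_upwards [Ioo_mem_nhdsLT (sub_lt_self x hδ)] with y hy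
    exact (h y hy.2.ne (by rw [abs_lt]; constructor <;> linarith [hy.1, hy.2])).symm

end LogDer

/-! ### The form in terms of the Schwarzian derivative -/

theorem ProjStr.contDiff_schwarzian (α : ProjStr) : ContDiff ℝ ∞ α.schwarzian := by
  induction α using Quotient.inductionOn with
  | h φ => exact contDiff_schwarz φ.immersion

theorem ProjStr.periodic_schwarzian (α : ProjStr) :
    Function.Periodic α.schwarzian (2 * Real.pi) := by
  induction α using Quotient.inductionOn with
  | h φ => exact periodic_schwarz φ

theorem periodic_deriv {f : ℝ → ℝ} {c : ℝ} (h : Function.Periodic f c) :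
    Function.Periodic (deriv f) c := by
  intro x
  rw [← deriv_comp_add_const]
  exact congrArg (fun f => deriv f x) (funext h)

theorem deriv_mem_Vect {ξ : ℝ → ℝ} (h : ξ ∈ Vect) : deriv ξ ∈ Vect :=
  ⟨contDiff_deriv h.1, periodic_deriv h.2⟩

theorem mul_mem_Vect {ξ η : ℝ → ℝ} (h : ξ ∈ Vect) (k : η ∈ Vect) :
    (fun x => ξ x * η x) ∈ Vect :=
  ⟨h.1.mul k.1, fun x => by simp only [h.2 x, k.2 x]⟩

theorem ProjStr.schwarzian_mem_Vect (α : ProjStr) : α.schwarzian ∈ Vect :=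
  ⟨α.contDiff_schwarzian, α.periodic_schwarzian⟩

theorem integral_eq_zero_of_hasDerivAt {f Z : ℝ → ℝ} (hf : Continuous f)
    (hZ : ∀ x, HasDerivAt Z (f x) x) (hper : Function.Periodic Z (2 * Real.pi)) :
    ∫ x in (0 : ℝ)..(2 * Real.pi), f x = 0 := by
  rw [intervalIntegral.integral_eq_sub_of_hasDerivAt (fun x _ => hZ x)
    (hf.intervalIntegrable _ _), sub_eq_zero]
  simpa using hper 0

theorem ProjStr.lie_apply (α : ProjStr) (ξ : Vect) (x : ℝ) :
    α.lie ξ x = ξ.1 x * deriv α.schwarzian x + 2 * deriv ξ.1 x * α.schwarzian x +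
      deriv (deriv (deriv ξ.1)) x := rfl

theorem ProjStr.lie_mem_Vect (α : ProjStr) (ξ : Vect) : α.lie ξ ∈ Vect := by
  have hq := α.schwarzian_mem_Vect
  have h1 := deriv_mem_Vect ξ.2
  have h3 := deriv_mem_Vect (deriv_mem_Vect h1)
  have := Vect.add_mem (Vect.add_mem (mul_mem_Vect ξ.2 (deriv_mem_Vect hq))
    (Vect.smul_mem 2 (mul_mem_Vect h1 hq))) h3
  convert this using 1
  funext x
  simp only [ProjStr.lie_apply, Pi.add_apply, Pi.smul_apply, smul_eq_mul]
  ring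

theorem continuous_of_mem_Vect {ξ : ℝ → ℝ} (h : ξ ∈ Vect) : Continuous ξ := h.1.continuous

/-- The integrands differ by the derivative of the periodic function qξη + ξ''η - ξ'η', with q the
Schwarzian. -/
theorem integral_lie_mul_eq (α : ProjStr) (ξ η : Vect) :
    ∫ x in (0 : ℝ)..(2 * Real.pi), α.lie ξ x * η.1 x =
      ∫ x in (0 : ℝ)..(2 * Real.pi), baseDensity α.schwarzian ξ.1 η.1 x := by
  have c1 : Continuous fun x => α.lie ξ x * η.1 x :=
    continuous_of_mem_Vect (mul_mem_Vect (α.lie_mem_Vect ξ) η.2)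
  have c2 := continuous_baseDensity α.contDiff_schwarzian.continuous ξ.2.1 η.2.1
  have dq := hasDerivAt_of_contDiff α.contDiff_schwarzian
  have d0 := hasDerivAt_of_contDiff ξ.2.1
  have d1 := hasDerivAt_of_contDiff (contDiff_deriv ξ.2.1)
  have d2 := hasDerivAt_of_contDiff (contDiff_deriv (contDiff_deriv ξ.2.1))
  have e0 := hasDerivAt_of_contDiff η.2.1
  have e1 := hasDerivAt_of_contDiff (contDiff_deriv η.2.1)
  rw [← sub_eq_zero, ← intervalIntegral.integral_sub (c1.intervalIntegrable _ _)
    (c2.intervalIntegrable _ _)]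
  refine integral_eq_zero_of_hasDerivAt (Z := fun x => α.schwarzian x * ξ.1 x * η.1 x +
    deriv (deriv ξ.1) x * η.1 x - deriv ξ.1 x * deriv η.1 x) (c1.sub c2) (fun x => ?_) ?_
  · refine (((((dq x).mul (d0 x)).mul (e0 x)).add ((d2 x).mul (e0 x))).sub
      ((d1 x).mul (e1 x))).congr_deriv ?_
    simp only [ProjStr.lie_apply, baseDensity, Pi.mul_apply]
    ring
  · intro x
    simp only [α.periodic_schwarzian x, ξ.2.2 x, η.2.2 x, periodic_deriv ξ.2.2 x,
      periodic_deriv η.2.2 x, periodic_deriv (periodic_deriv ξ.2.2) x]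

/-- The operator ∂³ + 2q∂ + q' is skew-adjoint on periodic functions. This makes the pairing
alternating and independent of the representing fields. -/
theorem integral_lie_mul_antisymm (α : ProjStr) (ξ η : Vect) :
    ∫ x in (0 : ℝ)..(2 * Real.pi), α.lie ξ x * η.1 x =
      -∫ x in (0 : ℝ)..(2 * Real.pi), α.lie η x * ξ.1 x := by
  have c1 : Continuous fun x => α.lie ξ x * η.1 x :=
    continuous_of_mem_Vect (mul_mem_Vect (α.lie_mem_Vect ξ) η.2)
  have c2 : Continuous fun x => α.lie η x * ξ.1 x :=
    continuous_of_mem_Vect (mul_mem_Vect (α.lie_mem_Vect η) ξ.2)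
  have dq := hasDerivAt_of_contDiff α.contDiff_schwarzian
  have d0 := hasDerivAt_of_contDiff ξ.2.1
  have d1 := hasDerivAt_of_contDiff (contDiff_deriv ξ.2.1)
  have d2 := hasDerivAt_of_contDiff (contDiff_deriv (contDiff_deriv ξ.2.1))
  have e0 := hasDerivAt_of_contDiff η.2.1
  have e1 := hasDerivAt_of_contDiff (contDiff_deriv η.2.1)
  have e2 := hasDerivAt_of_contDiff (contDiff_deriv (contDiff_deriv η.2.1))
  rw [eq_neg_iff_add_eq_zero, ← intervalIntegral.integral_add (c1.intervalIntegrable _ _)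
    (c2.intervalIntegrable _ _)]
  refine integral_eq_zero_of_hasDerivAt (Z := fun x => 2 * (α.schwarzian x * ξ.1 x * η.1 x) +
    deriv (deriv ξ.1) x * η.1 x - deriv ξ.1 x * deriv η.1 x + ξ.1 x * deriv (deriv η.1) x)
    (c1.add c2) (fun x => ?_) ?_
  · refine ((((((dq x).mul (d0 x)).mul (e0 x)).const_mul 2).add ((d2 x).mul (e0 x))).sub
      ((d1 x).mul (e1 x))).add ((d0 x).mul (e2 x)) |>.congr_deriv ?_
    simp only [ProjStr.lie_apply, Pi.mul_apply]
    ring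
  · intro x
    simp only [α.periodic_schwarzian x, ξ.2.2 x, η.2.2 x, periodic_deriv ξ.2.2 x,
      periodic_deriv η.2.2 x, periodic_deriv (periodic_deriv ξ.2.2) x,
      periodic_deriv (periodic_deriv η.2.2) x]

theorem ProjStr.exists_vel_eq (α : ProjStr) (δ : α.Tangent) : ∃ ξ : Vect, α.vel ξ = δ :=
  LinearMap.surjective_rangeRestrict _ δ

/-- A vector field that represents a tangent vector. -/
def ProjStr.field (α : ProjStr) (δ : α.Tangent) : Vect := (α.exists_vel_eq δ).choose

theorem ProjStr.vel_field (α : ProjStr) (δ : α.Tangent) : α.vel (α.field δ) = δ :=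
  (α.exists_vel_eq δ).choose_spec

theorem ProjStr.coe_vel (α : ProjStr) (ξ : Vect) : (α.vel ξ : ℝ → ℝ) = α.lie ξ := rfl

/-- The integral of the product of `L_ξ α` and a vector field `η` depends only on `L_ξ α`
and `L_η α`. -/
theorem integral_mul_eq_of_vel_eq {α : ProjStr} (δ : α.Tangent) {η η' : Vect}
    (h : α.vel η = α.vel η') :
    ∫ x in (0 : ℝ)..(2 * Real.pi), (δ : ℝ → ℝ) x * η.1 x =
      ∫ x in (0 : ℝ)..(2 * Real.pi), (δ : ℝ → ℝ) x * η'.1 x := by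
  obtain ⟨ξ, rfl⟩ := α.exists_vel_eq δ
  have h' : α.lie η = α.lie η' := by rw [← α.coe_vel, h, α.coe_vel]
  rw [α.coe_vel, integral_lie_mul_antisymm, h', ← integral_lie_mul_antisymm]

theorem ProjStr.tangent_mem_Vect {α : ProjStr} (δ : α.Tangent) : (δ : ℝ → ℝ) ∈ Vect := by
  obtain ⟨ξ, rfl⟩ := α.exists_vel_eq δ
  exact α.lie_mem_Vect ξ

theorem intervalIntegrable_mul {f g : ℝ → ℝ} (h : f ∈ Vect) (k : g ∈ Vect) (a b : ℝ) :
    IntervalIntegrable (fun x => f x * g x) volume a b :=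
  (continuous_of_mem_Vect (mul_mem_Vect h k)).intervalIntegrable _ _

/-- The symplectic form. -/
def ProjStr.form (α : ProjStr) : LinearMap.BilinForm ℝ α.Tangent :=
  LinearMap.mk₂ ℝ
    (fun δ₁ δ₂ => ∫ x in (0 : ℝ)..(2 * Real.pi), (δ₁ : ℝ → ℝ) x * (α.field δ₂).1 x)
    (fun δ δ' ε => by
      rw [← intervalIntegral.integral_add
        (intervalIntegrable_mul (α.tangent_mem_Vect δ) (α.field ε).2 _ _)
        (intervalIntegrable_mul (α.tangent_mem_Vect δ') (α.field ε).2 _ _)]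
      simp only [Submodule.coe_add, Pi.add_apply, add_mul])
    (fun c δ ε => by
      rw [smul_eq_mul, ← intervalIntegral.integral_const_mul]
      simp only [Submodule.coe_smul, Pi.smul_apply, smul_eq_mul, mul_assoc])
    (fun δ ε ε' => by
      -- The chosen fields need not be additive, but the discrepancy is an infinitesimal
      -- automorphism, to which the integral is blind.
      have h : α.vel (α.field (ε + ε')) = α.vel (α.field ε + α.field ε') := by
        rw [α.vel_field, ProjStr.vel, map_add]
        exact congrArg₂ _ (α.vel_field ε).symm (α.vel_field ε').symm
      rw [integral_mul_eq_of_vel_eq δ h, ← intervalIntegral.integral_add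
        (intervalIntegrable_mul (α.tangent_mem_Vect δ) (α.field ε).2 _ _)
        (intervalIntegrable_mul (α.tangent_mem_Vect δ) (α.field ε').2 _ _)]
      simp only [Submodule.coe_add, Pi.add_apply, mul_add])
    (fun c δ ε => by
      have h : α.vel (α.field (c • ε)) = α.vel (c • α.field ε) := by
        rw [α.vel_field, ProjStr.vel, map_smul]
        exact congrArg _ (α.vel_field ε).symm
      rw [integral_mul_eq_of_vel_eq δ h, smul_eq_mul, ← intervalIntegral.integral_const_mul]
      simp only [Submodule.coe_smul, Pi.smul_apply, smul_eq_mul]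
      congr 1
      funext x
      ring)

theorem ProjStr.form_vel (α : ProjStr) (ξ η : Vect) :
    α.form (α.vel ξ) (α.vel η) = ∫ x in (0 : ℝ)..(2 * Real.pi), α.lie ξ x * η.1 x :=
  integral_mul_eq_of_vel_eq (α.vel ξ) (α.vel_field (α.vel η))

theorem ProjStr.form_vel_eq_base (α : ProjStr) (ξ η : Vect) :
    α.form (α.vel ξ) (α.vel η) =
      ∫ x in (0 : ℝ)..(2 * Real.pi), baseDensity α.schwarzian ξ.1 η.1 x := by
  rw [α.form_vel, integral_lie_mul_eq]

theorem ProjStr.form_isAlt (α : ProjStr) : α.form.IsAlt := by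
  intro δ
  obtain ⟨ξ, rfl⟩ := α.exists_vel_eq δ
  have := integral_lie_mul_antisymm α ξ ξ
  rw [α.form_vel]
  linarith

theorem ProjStr.form_nondegenerate (α : ProjStr) : α.form.Nondegenerate := by
  have hl : α.form.SeparatingLeft := by
    intro δ h
    obtain ⟨ξ, rfl⟩ := α.exists_vel_eq δ
    -- Testing against L_ξα itself, read as a vector field, gives ∫ (L_ξα)² = 0.
    have h0 := h (α.vel ⟨_, α.lie_mem_Vect ξ⟩)
    rw [α.form_vel] at h0
    have hc := continuous_of_mem_Vect (α.lie_mem_Vect ξ)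
    have hper := (α.lie_mem_Vect ξ).2
    have h2 : ∀ x ∈ Set.Icc 0 (2 * Real.pi), α.lie ξ x = 0 := by
      by_contra! hne
      obtain ⟨x, hx, hx'⟩ := hne
      have := intervalIntegral.integral_pos (f := fun x => α.lie ξ x * α.lie ξ x)
        Real.two_pi_pos (hc.mul hc).continuousOn (fun x _ => mul_self_nonneg _)
        ⟨x, hx, mul_self_pos.2 hx'⟩
      exact this.ne' h0
    refine Subtype.ext (funext fun x => ?_)
    obtain ⟨y, hy, hxy⟩ := hper.exists_mem_Ico₀ Real.two_pi_pos x
    rw [α.coe_vel, hxy]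
    exact h2 y ⟨hy.1, hy.2.le⟩
  refine ⟨hl, fun δ h => hl δ fun ε => ?_⟩
  rw [← α.form_isAlt.neg_eq, h ε, neg_zero]

theorem periodic_baseDensity {q ξ η : ℝ → ℝ} {c : ℝ} (hq : Function.Periodic q c)
    (h : Function.Periodic ξ c) (k : Function.Periodic η c) :
    Function.Periodic (baseDensity q ξ η) c := by
  intro x
  simp only [baseDensity, hq x, h x, k x, periodic_deriv h x, periodic_deriv k x,
    periodic_deriv (periodic_deriv k) x]

theorem ProjStr.form_vel_eq_from (α : ProjStr) (ξ η : Vect) (x₀ : ℝ) :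
    α.form (α.vel ξ) (α.vel η) =
      ∫ x in x₀..(x₀ + 2 * Real.pi), baseDensity α.schwarzian ξ.1 η.1 x := by
  rw [α.form_vel_eq_base, (periodic_baseDensity α.periodic_schwarzian ξ.2.2 η.2.2
    ).intervalIntegral_add_eq x₀ 0, zero_add]

theorem hasFinitePart_form {α : ProjStr} {φ : DevMap} (hφ : φ.struct = α) (g : GL (Fin 2) ℝ)
    {x₀ : ℝ} {ξ₁ ξ₂ : Vect} (h₁ : ξ₁.1 x₀ = 0) (h₂ : ξ₂.1 x₀ = 0) :
    HasFinitePart (poles g φ) (density (pullForm g φ) ξ₁.1 ξ₂.1) x₀ (x₀ + 2 * Real.pi)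
      (α.form (α.vel ξ₁) (α.vel ξ₂)) := by
  rw [ProjStr.form_vel_eq_from _ _ _ x₀, ← hφ]
  exact hasFinitePart_density ξ₁.2.1 ξ₂.2.1 (by linarith [Real.two_pi_pos]) ⟨h₁, h₂⟩
    ⟨(ξ₁.2.2 x₀).trans h₁, (ξ₂.2.2 x₀).trans h₂⟩

theorem form_isGivenByIntegral (T : GL (Fin 2) ℝ) :
    IsGivenByIntegral (T := T) fun α δ₁ δ₂ => α.1.form δ₁ δ₂ :=
  fun _ _ hφ g _ _ _ h₁ h₂ => hasFinitePart_form hφ g h₁ h₂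

theorem form_eq_ordinary_integral {α : ProjStr} {φ : DevMap} (hφ : φ.struct = α)
    (g : GL (Fin 2) ℝ) {x₀ : ℝ} {ξ₁ ξ₂ : Vect} (h₁ : ξ₁.1 x₀ = 0) (h₂ : ξ₂.1 x₀ = 0)
    (hfin : ∀ x ∈ Set.Ioo x₀ (x₀ + 2 * Real.pi), g • φ.toFun x ≠ OnePoint.infty) :
    IntervalIntegrable (density (pullForm g φ) ξ₁.1 ξ₂.1) volume x₀ (x₀ + 2 * Real.pi) ∧
      ∫ x in x₀..(x₀ + 2 * Real.pi), density (pullForm g φ) ξ₁.1 ξ₂.1 x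
        = α.form (α.vel ξ₁) (α.vel ξ₂) := by
  have hlt : x₀ < x₀ + 2 * Real.pi := by linarith [Real.two_pi_pos]
  have h₁' := (ξ₁.2.2 x₀).trans h₁
  have h₂' := (ξ₂.2.2 x₀).trans h₂
  have hi : IntervalIntegrable (density (pullForm g φ) ξ₁.1 ξ₂.1) volume x₀
      (x₀ + 2 * Real.pi) := by
    refine intervalIntegrable_density ξ₁.2.1 ξ₂.2.1 hlt fun x hx hp => ?_
    rcases hx.1.eq_or_lt with rfl | hx1
    · exact ⟨h₁, h₂⟩
    rcases hx.2.eq_or_lt with rfl | hx2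
    · exact ⟨h₁', h₂'⟩
    exact absurd hp (hfin x ⟨hx1, hx2⟩)
  refine ⟨hi, HasFinitePart.integral_eq hlt.le hfin (isClosed_poles g φ) hi
    (hasFinitePart_form hφ g h₁ h₂)⟩

/-! ### Infinitesimal automorphisms of a projective structure -/

/-- The vector field on the affine line with flow the homographies `exp (s X)`. -/
def quadField (X : Matrix (Fin 2) (Fin 2) ℝ) (t : ℝ) : ℝ :=
  X 0 0 * t + X 0 1 - t * (X 1 0 * t + X 1 1)

/-- Naturality: the homography B, of derivative det B / (ct + d)², carries the field of X to that of
BXB⁻¹. Denominators are cleared. -/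
theorem quadField_conj {X Y B : Matrix (Fin 2) (Fin 2) ℝ} (h : Y * B = B * X) {t : ℝ}
    (ht : B 1 0 * t + B 1 1 ≠ 0) :
    quadField Y ((B 0 0 * t + B 0 1) / (B 1 0 * t + B 1 1)) * (B 1 0 * t + B 1 1) ^ 2 =
      (B 0 0 * B 1 1 - B 0 1 * B 1 0) * quadField X t := by
  have e (i j : Fin 2) := congrFun (congrFun h i) j
  simp only [Matrix.mul_apply, Fin.sum_univ_two] at e
  have hom : ∀ u v : ℝ, v ≠ 0 → quadField Y (u / v) * v ^ 2 =
      (Y 0 0 * u + Y 0 1 * v) * v - u * (Y 1 0 * u + Y 1 1 * v) := by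
    intro u v hv
    unfold quadField
    field_simp
  rw [hom _ _ ht]
  unfold quadField
  linear_combination (B 1 0 * t + B 1 1) * (t * e 0 0 + e 0 1) -
    (B 0 0 * t + B 0 1) * (t * e 1 0 + e 1 1)

theorem hasDerivAt_quadField (X : Matrix (Fin 2) (Fin 2) ℝ) {f : ℝ → ℝ} {f' x : ℝ}
    (hf : HasDerivAt f f' x) :
    HasDerivAt (fun y => quadField X (f y)) ((X 0 0 - X 1 1 - 2 * X 1 0 * f x) * f') x := by
  refine (((hf.const_mul (X 0 0)).add_const (X 0 1)).sub
    (hf.mul ((hf.const_mul (X 1 0)).add_const (X 1 1)))).congr_deriv ?_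
  ring

variable (φ : DevMap) (X : Matrix (Fin 2) (Fin 2) ℝ)

/-- The pull-back of the vector field of `X` by a developing map, in the chart `g`. -/
def pullFieldIn (g : GL (Fin 2) ℝ) (x : ℝ) : ℝ :=
  quadField (g.1 * X * (g⁻¹).1) (coord (g • φ.toFun x)) / pullForm g φ x

/-- The pull-back of the vector field of `X` by a developing map. -/
def pullField (x : ℝ) : ℝ := pullFieldIn φ X (exists_chart φ.immersion x).choose x

variable {φ X}

/-- Changing chart multiplies the field and θ by the same factor, the derivative of the transition
homography. Thus the arbitrary chart in `pullField` is harmless. -/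
theorem pullFieldIn_eq {g g' : GL (Fin 2) ℝ} {x : ℝ} (hg : x ∉ poles g φ) (hg' : x ∉ poles g' φ) :
    pullFieldIn φ X g x = pullFieldIn φ X g' x := by
  obtain ⟨h1, h2, h3⟩ := chart_spec φ.immersion g hg
  obtain ⟨B, hB, hne, he⟩ := chart_change (f := fun y => coord (g • φ.toFun y)) (h := g)
    (by filter_upwards [h3] with y hy using (coe_coord hy).symm) h1 g' hg'
  have hconj : (g'.1 * X * (g'⁻¹).1) * B.1 = B.1 * (g.1 * X * (g⁻¹).1) := by
    rw [hB]
    have i1 : (g'⁻¹).1 * g'.1 = 1 := g'.inv_mul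
    have i2 : (g⁻¹).1 * g.1 = 1 := g.inv_mul
    rw [Units.val_mul]
    simp only [Matrix.mul_assoc]
    rw [← Matrix.mul_assoc (g'⁻¹).1, i1, Matrix.one_mul, ← Matrix.mul_assoc (g⁻¹).1, i2,
      Matrix.one_mul]
  have heq : (fun y => coord (g' • φ.toFun y)) =ᶠ[𝓝 x] fun y =>
      (B 0 0 * coord (g • φ.toFun y) + B 0 1) / (B 1 0 * coord (g • φ.toFun y) + B 1 1) := by
    filter_upwards [he] with y hy
    rw [hy.2]
    rfl
  have D : HasDerivAt (fun y => coord (g • φ.toFun y)) (pullForm g φ x) x :=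
    hasDerivAt_of_contDiffAt h1
  have hd : pullForm g' φ x = _ := heq.deriv_eq.trans
    (((D.const_mul (B 0 0)).add_const (B 0 1)).div ((D.const_mul (B 1 0)).add_const (B 1 1))
      hne).deriv
  have hq := quadField_conj hconj hne
  have hdet := GL_det_ne_zero B
  have hθ := pullForm_ne_zero hg
  have hd' : pullForm g' φ x = (B 0 0 * B 1 1 - B 0 1 * B 1 0) * pullForm g φ x /
      (B 1 0 * coord (g • φ.toFun x) + B 1 1) ^ 2 := by
    rw [hd]
    congr 1
    ring
  unfold pullFieldIn
  rw [hd', heq.eq_of_nhds, div_div_eq_mul_div, hq]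
  field_simp

theorem pullField_eq {g : GL (Fin 2) ℝ} {x : ℝ} (hg : x ∉ poles g φ) :
    pullField φ X x = pullFieldIn φ X g x :=
  pullFieldIn_eq (exists_chart φ.immersion x).choose_spec hg

theorem pullField_eventuallyEq {g : GL (Fin 2) ℝ} {x : ℝ} (hg : x ∉ poles g φ) :
    pullField φ X =ᶠ[𝓝 x] pullFieldIn φ X g := by
  filter_upwards [(isClosed_poles g φ).isOpen_compl.mem_nhds hg] with y hy
  exact pullField_eq hy

theorem contDiff_pullField : ContDiff ℝ ∞ (pullField φ X) := by
  refine contDiff_iff_contDiffAt.2 fun x => ?_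
  obtain ⟨g, hg⟩ := exists_chart φ.immersion x
  refine ContDiffAt.congr_of_eventuallyEq ?_ (pullField_eventuallyEq hg)
  have h1 := (chart_spec φ.immersion g hg).1
  refine ContDiffAt.div ?_ (contDiffAt_pullForm hg) (pullForm_ne_zero hg)
  unfold quadField
  fun_prop

/-- Translation by a period replaces the chart g by gT, and conjugation by T fixes X. -/
theorem periodic_pullField {T : GL (Fin 2) ℝ} (hT : ∀ x, φ.toFun (x + 2 * Real.pi) = T • φ.toFun x)
    (hX : T.1 * X = X * T.1) : Function.Periodic (pullField φ X) (2 * Real.pi) := by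
  intro x
  obtain ⟨g, hg⟩ := exists_chart φ.immersion (x + 2 * Real.pi)
  have hg' : x ∉ poles (g * T) φ := by
    intro h
    refine hg ?_
    rw [hT, ← mul_smul]
    exact h
  have hf : (fun y => coord (g • φ.toFun (y + 2 * Real.pi))) =
      fun y => coord ((g * T) • φ.toFun y) := by
    funext y
    rw [hT, mul_smul]
  have hθ : pullForm g φ (x + 2 * Real.pi) = pullForm (g * T) φ x := by
    unfold pullForm
    rw [← hf]
    exact (deriv_comp_add_const (fun y => coord (g • φ.toFun y)) (2 * Real.pi) x).symm
  have hm : (g * T).1 * X * ((g * T)⁻¹).1 = g.1 * X * (g⁻¹).1 := by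
    have i1 : T.1 * (T⁻¹).1 = 1 := T.mul_inv
    rw [mul_inv_rev, Units.val_mul, Units.val_mul, Matrix.mul_assoc g.1, hX]
    simp only [Matrix.mul_assoc]
    rw [← Matrix.mul_assoc T.1, i1, Matrix.one_mul]
  rw [pullField_eq hg, pullField_eq hg']
  unfold pullFieldIn
  rw [hθ, hm, hT, mul_smul]

/-- In the affine parameter t the equation says that the third derivative of the field vanishes, as
it does for a quadratic polynomial. In x this is checked by differentiating Y(t)/t' three times,
using the Riccati equation at each occurrence of ρ'. -/
theorem killing_pullField (x : ℝ) :
    pullField φ X x * deriv (schwarz φ.toFun) x +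
      2 * deriv (pullField φ X) x * schwarz φ.toFun x +
      deriv (deriv (deriv (pullField φ X))) x = 0 := by
  obtain ⟨g, hg⟩ := exists_chart φ.immersion x
  set Y := g.1 * X * (g⁻¹).1 with hY
  set t := fun y => coord (g • φ.toFun y) with ht
  set q := schwarz φ.toFun with hq
  have hopen : ∀ᶠ y in 𝓝 x, y ∉ poles g φ := (isClosed_poles g φ).isOpen_compl.mem_nhds hg
  have D0 : ∀ y ∉ poles g φ, HasDerivAt t (pullForm g φ y) y := fun y hy =>
    hasDerivAt_of_contDiffAt (chart_spec φ.immersion g hy).1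
  have D1 : ∀ y ∉ poles g φ, HasDerivAt (pullForm g φ) (logDer g φ y * pullForm g φ y) y := by
    intro y hy
    refine (hasDerivAt_of_contDiffAt (contDiffAt_pullForm hy)).congr_deriv ?_
    rw [logDer, div_mul_cancel₀ _ (pullForm_ne_zero hy)]
  have Dq := hasDerivAt_of_contDiff (contDiff_schwarz φ.immersion)
  have E0 := pullField_eventuallyEq (X := X) hg
  have H0 : ∀ᶠ y in 𝓝 x, HasDerivAt (pullField φ X)
      (Y 0 0 - Y 1 1 - 2 * Y 1 0 * t y - logDer g φ y * pullField φ X y) y := by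
    filter_upwards [hopen, E0.eventually_nhds] with y hy hy'
    have h0 := pullForm_ne_zero hy
    have hy' : pullField φ X =ᶠ[𝓝 y] pullFieldIn φ X g := hy'
    have := ((hasDerivAt_quadField Y (D0 y hy)).div (D1 y hy) h0).congr_of_eventuallyEq hy'
    refine this.congr_deriv ?_
    rw [hy'.eq_of_nhds, pullFieldIn]
    field_simp
    exact congrArg _ (mul_comm _ _)
  have H1 : ∀ᶠ y in 𝓝 x, HasDerivAt (deriv (pullField φ X))
      (-(2 * Y 1 0 * pullForm g φ y) - q y * pullField φ X y
        - logDer g φ y * (Y 0 0 - Y 1 1 - 2 * Y 1 0 * t y)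
        + logDer g φ y ^ 2 / 2 * pullField φ X y) y := by
    filter_upwards [hopen, H0.eventually_nhds] with y hy hy'
    have e : deriv (pullField φ X) =ᶠ[𝓝 y] fun y =>
        Y 0 0 - Y 1 1 - 2 * Y 1 0 * t y - logDer g φ y * pullField φ X y := by
      filter_upwards [hy'] with z hz using hz.deriv
    have := ((((D0 y hy).const_mul (2 * Y 1 0)).const_sub (Y 0 0 - Y 1 1)).sub
      ((hasDerivAt_logDer hy).mul hy'.self_of_nhds)).congr_of_eventuallyEq e
    refine this.congr_deriv ?_
    ring
  have e : deriv (deriv (pullField φ X)) =ᶠ[𝓝 x] fun y =>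
      -(2 * Y 1 0 * pullForm g φ y) - q y * pullField φ X y
        - logDer g φ y * (Y 0 0 - Y 1 1 - 2 * Y 1 0 * t y)
        + logDer g φ y ^ 2 / 2 * pullField φ X y := by
    filter_upwards [H1] with z hz using hz.deriv
  have H2 := ((((((D1 x hg).const_mul (2 * Y 1 0)).neg).sub ((Dq x).mul H0.self_of_nhds)).sub
    ((hasDerivAt_logDer hg).mul
      (((D0 x hg).const_mul (2 * Y 1 0)).const_sub (Y 0 0 - Y 1 1)))).add
    ((((hasDerivAt_logDer hg).pow 2).div_const 2).mul H0.self_of_nhds)).congr_of_eventuallyEq e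
  rw [H2.deriv, H0.self_of_nhds.deriv]
  simp only [Pi.pow_apply]
  ring

/-- If the pull-back vanished, the quadratic polynomial of a conjugate Y of X would vanish on an
open set of values of t. Differentiating twice kills its coefficients one by one, so Y and hence X
would be scalar. -/
theorem exists_pullField_ne_zero (hX : ∀ c : ℝ, X ≠ c • (1 : Matrix (Fin 2) (Fin 2) ℝ)) :
    ∃ x, pullField φ X x ≠ 0 := by
  by_contra! hzero
  obtain ⟨g, hg⟩ := exists_chart φ.immersion 0
  set Y := g.1 * X * (g⁻¹).1 with hY
  set t := fun y => coord (g • φ.toFun y) with ht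
  have hopen : ∀ᶠ y in 𝓝 (0 : ℝ), y ∉ poles g φ := (isClosed_poles g φ).isOpen_compl.mem_nhds hg
  have D0 : ∀ y ∉ poles g φ, HasDerivAt t (pullForm g φ y) y := fun y hy =>
    hasDerivAt_of_contDiffAt (chart_spec φ.immersion g hy).1
  have z0 : ∀ᶠ y in 𝓝 (0 : ℝ), quadField Y (t y) = 0 := by
    filter_upwards [hopen] with y hy
    have := hzero y
    rw [pullField_eq hy, pullFieldIn] at this
    exact (div_eq_zero_iff.1 this).resolve_right (pullForm_ne_zero hy)
  have z1 : ∀ᶠ y in 𝓝 (0 : ℝ), Y 0 0 - Y 1 1 - 2 * Y 1 0 * t y = 0 := by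
    filter_upwards [hopen, z0.eventually_nhds] with y hy hy'
    have h1 := (hasDerivAt_quadField Y (D0 y hy)).deriv
    have h2 : (fun y => quadField Y (t y)) =ᶠ[𝓝 y] fun _ => 0 := hy'
    rw [h2.deriv_eq, deriv_const] at h1
    exact (mul_eq_zero.1 h1.symm).resolve_right (pullForm_ne_zero hy)
  have z2 : Y 1 0 = 0 := by
    have h1 := (((D0 0 hg).const_mul (2 * Y 1 0)).const_sub (Y 0 0 - Y 1 1)).deriv
    have h2 : (fun y => Y 0 0 - Y 1 1 - 2 * Y 1 0 * t y) =ᶠ[𝓝 0] fun _ => 0 := z1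
    rw [h2.deriv_eq, deriv_const] at h1
    have h3 := pullForm_ne_zero hg
    have h4 : Y 1 0 * pullForm g φ 0 = 0 := by linarith
    exact (mul_eq_zero.1 h4).resolve_right h3
  have z1' := z1.self_of_nhds
  have z0' := z0.self_of_nhds
  rw [z2] at z1'
  have z3 : Y 0 0 = Y 1 1 := by linarith
  have z4 : Y 0 1 = 0 := by
    unfold quadField at z0'
    rw [z2, z3] at z0'
    linarith
  have hYs : Y = Y 1 1 • (1 : Matrix (Fin 2) (Fin 2) ℝ) := by
    ext i j
    fin_cases i <;> fin_cases j <;> simp [z2, z3, z4]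
  refine hX (Y 1 1) ?_
  have i2 : (g⁻¹).1 * g.1 = 1 := g.inv_mul
  calc X = (g⁻¹).1 * Y * g.1 := by
        rw [hY]
        simp only [Matrix.mul_assoc]
        rw [i2, Matrix.mul_one, ← Matrix.mul_assoc, i2, Matrix.one_mul]
    _ = _ := by rw [hYs]; simp

theorem exists_commuting_nonscalar (T : Matrix (Fin 2) (Fin 2) ℝ) :
    ∃ X : Matrix (Fin 2) (Fin 2) ℝ, T * X = X * T ∧
      ∀ c : ℝ, X ≠ c • (1 : Matrix (Fin 2) (Fin 2) ℝ) := by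
  by_cases h : ∃ c : ℝ, T = c • (1 : Matrix (Fin 2) (Fin 2) ℝ)
  · obtain ⟨c, rfl⟩ := h
    -- Everything commutes with a scalar T, so any nonscalar matrix serves; a nonscalar T serves
    -- itself.
    refine ⟨!![0, 1; 0, 0], by simp, fun d hd => ?_⟩
    have := congrFun (congrFun hd 0) 1
    simp at this
  · exact ⟨T, rfl, fun c hc => h ⟨c, hc⟩⟩

/-- A structure has a nonzero infinitesimal automorphism. -/
theorem exists_automorphism {T : GL (Fin 2) ℝ} (α : PT T) :
    ∃ η : Vect, α.1.lie η = 0 ∧ ∃ x, η.1 x ≠ 0 := by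
  obtain ⟨φ, hφ, hT⟩ := α.2
  obtain ⟨X, hX, hX'⟩ := exists_commuting_nonscalar T.1
  refine ⟨⟨pullField φ X, contDiff_pullField, periodic_pullField hT hX⟩, ?_,
    exists_pullField_ne_zero hX'⟩
  rw [← hφ]
  exact funext killing_pullField

theorem exists_point_representing {T : GL (Fin 2) ℝ} (α : PT T) :
    ∃ x₀ : ℝ, ∀ δ : α.1.Tangent, ∃ ξ : Vect, ξ.1 x₀ = 0 ∧ α.1.vel ξ = δ := by
  obtain ⟨η, hη, x₀, hx₀⟩ := exists_automorphism α
  refine ⟨x₀, fun δ => ?_⟩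
  obtain ⟨ξ, rfl⟩ := α.1.exists_vel_eq δ
  refine ⟨ξ - (ξ.1 x₀ / η.1 x₀) • η, ?_, ?_⟩
  · simp [div_mul_cancel₀ _ hx₀]
  · refine Subtype.ext ?_
    rw [α.1.coe_vel, α.1.coe_vel, map_sub, map_smul, hη, smul_zero, sub_zero]

/-- One x₀ serves both tangent vectors, so the condition constrains every pair, and finite parts are
unique. -/
theorem isGivenByIntegral_unique {T : GL (Fin 2) ℝ}
    {σ σ' : ∀ α : PT T, α.1.Tangent → α.1.Tangent → ℝ} (h : IsGivenByIntegral σ)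
    (h' : IsGivenByIntegral σ') (α : PT T) (δ₁ δ₂ : α.1.Tangent) : σ' α δ₁ δ₂ = σ α δ₁ δ₂ := by
  obtain ⟨φ, hφ, -⟩ := α.2
  obtain ⟨x₀, hx₀⟩ := exists_point_representing α
  obtain ⟨ξ₁, h₁, rfl⟩ := hx₀ δ₁
  obtain ⟨ξ₂, h₂, rfl⟩ := hx₀ δ₂
  exact finitePart_unique (h' α φ hφ 1 x₀ ξ₁ ξ₂ h₁ h₂) (h α φ hφ 1 x₀ ξ₁ ξ₂ h₁ h₂)

/-! ### Directional derivatives of smooth functions with parameters -/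

section Directional

variable {E : Type} [NormedAddCommGroup E] [NormedSpace ℝ E]

/-- The directional derivative. -/
def dirDeriv (v : E) (f : E → ℝ) (p : E) : ℝ := fderiv ℝ f p v

variable {f g : E → ℝ}

theorem differentiableAt_of_contDiff (hf : ContDiff ℝ ∞ f) (p : E) : DifferentiableAt ℝ f p :=
  hf.differentiable (by simp) p

theorem contDiff_dirDeriv (hf : ContDiff ℝ ∞ f) (v : E) : ContDiff ℝ ∞ (dirDeriv v f) :=
  (hf.fderiv_right (m := ∞) (by simp)).clm_apply contDiff_const

theorem dirDeriv_comm (hf : ContDiff ℝ ∞ f) (v w : E) :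
    dirDeriv v (dirDeriv w f) = dirDeriv w (dirDeriv v f) := by
  funext p
  have hd : DifferentiableAt ℝ (fderiv ℝ f) p :=
    ((hf.fderiv_right (m := ∞) (by simp)).differentiable (by simp)) p
  have key : ∀ v w : E, dirDeriv v (dirDeriv w f) p = fderiv ℝ (fderiv ℝ f) p v w := by
    intro v w
    have : HasFDerivAt (dirDeriv w f) _ p :=
      hd.hasFDerivAt.clm_apply (hasFDerivAt_const w p)
    rw [dirDeriv, this.fderiv]
    simp
  rw [key, key]
  exact (contDiff_infty.1 hf 2).contDiffAt.isSymmSndFDerivAt (by simp) v w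

theorem dirDeriv_add (hf : ContDiff ℝ ∞ f) (hg : ContDiff ℝ ∞ g) (v p : E) :
    dirDeriv v (fun p => f p + g p) p = dirDeriv v f p + dirDeriv v g p := by
  unfold dirDeriv
  rw [fderiv_fun_add (differentiableAt_of_contDiff hf p) (differentiableAt_of_contDiff hg p)]
  rfl

theorem dirDeriv_mul (hf : ContDiff ℝ ∞ f) (hg : ContDiff ℝ ∞ g) (v p : E) :
    dirDeriv v (fun p => f p * g p) p = dirDeriv v f p * g p + f p * dirDeriv v g p := by
  unfold dirDeriv
  rw [fderiv_fun_mul (differentiableAt_of_contDiff hf p) (differentiableAt_of_contDiff hg p)]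
  simp
  ring

theorem dirDeriv_const_mul (hf : ContDiff ℝ ∞ f) (c : ℝ) (v p : E) :
    dirDeriv v (fun p => c * f p) p = c * dirDeriv v f p := by
  unfold dirDeriv
  rw [fderiv_const_mul (differentiableAt_of_contDiff hf p)]
  simp

variable {F : E × ℝ → ℝ}

theorem deriv_slice (hF : ContDiff ℝ ∞ F) (s : E) :
    deriv (fun x => F (s, x)) = fun x => dirDeriv (0, 1) F (s, x) := by
  funext x
  have h : HasDerivAt (fun x : ℝ => (s, x)) ((0 : E), (1 : ℝ)) x :=
    (hasDerivAt_const x s).prodMk (hasDerivAt_id x)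
  exact ((differentiableAt_of_contDiff hF (s, x)).hasFDerivAt.comp_hasDerivAt x h).deriv

theorem hasFDerivAt_slice (hF : ContDiff ℝ ∞ F) (s : E) (x : ℝ) :
    HasFDerivAt (fun r => F (r, x)) ((fderiv ℝ F (s, x)).comp (ContinuousLinearMap.inl ℝ E ℝ)) s :=
  (differentiableAt_of_contDiff hF (s, x)).hasFDerivAt.comp s (hasFDerivAt_prodMk_left s x)

theorem fderiv_slice (hF : ContDiff ℝ ∞ F) (s v : E) (x : ℝ) :
    fderiv ℝ (fun r => F (r, x)) s v = dirDeriv (v, 0) F (s, x) := by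
  rw [(hasFDerivAt_slice hF s x).fderiv]
  rfl

theorem contDiff_slice (hF : ContDiff ℝ ∞ F) (s : E) : ContDiff ℝ ∞ fun x => F (s, x) :=
  hF.comp (contDiff_prodMk_right s)

theorem fderiv_parametric_integral (hF : ContDiff ℝ ∞ F) (a b : ℝ) (s v : E) :
    fderiv ℝ (fun s => ∫ x in a..b, F (s, x)) s v =
      ∫ x in a..b, dirDeriv (v, 0) F (s, x) := by
  rw [(hasFDerivAt_parametric_integral (hF.of_le (by simp)) a b s).fderiv]
  rw [ContinuousLinearMap.intervalIntegral_apply]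
  · rfl
  · have h1 := (hF.fderiv_right (m := ∞) (by simp)).continuous
    exact Continuous.intervalIntegrable (by fun_prop) _ _

end Directional

/-! ### Closedness -/

theorem integral_add_add {f g k : ℝ → ℝ} (hf : Continuous f) (hg : Continuous g)
    (hk : Continuous k) (a b : ℝ) :
    ∫ x in a..b, (f x + g x + k x) =
      (∫ x in a..b, f x) + (∫ x in a..b, g x) + ∫ x in a..b, k x := by
  have hfg : Continuous fun x => f x + g x := hf.add hg
  rw [intervalIntegral.integral_add (hfg.intervalIntegrable a b)
    (hk.intervalIntegrable a b), intervalIntegral.integral_add (hf.intervalIntegrable a b)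
    (hg.intervalIntegrable a b)]

/-- Subtracting the derivatives of the products (Lξ₁)ξ₀ξ₂ leaves the cyclic sum of Lξ₁ · (ξ₀'ξ₂ -
ξ₀ξ₂'). There the terms in q and q' cancel, and the third-order terms are the derivative of the
cyclic sum of ξ₁''(ξ₀'ξ₂ - ξ₀ξ₂'). -/
theorem integral_cocycle_eq_zero (α : ProjStr) (ξ₀ ξ₁ ξ₂ : Vect) :
    ∫ x in (0 : ℝ)..(2 * Real.pi),
      ((ξ₀.1 x * deriv (α.lie ξ₁) x + 2 * deriv ξ₀.1 x * α.lie ξ₁ x) * ξ₂.1 x +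
        (ξ₁.1 x * deriv (α.lie ξ₂) x + 2 * deriv ξ₁.1 x * α.lie ξ₂ x) * ξ₀.1 x +
        (ξ₂.1 x * deriv (α.lie ξ₀) x + 2 * deriv ξ₂.1 x * α.lie ξ₀ x) * ξ₁.1 x) = 0 := by
  have c0 (ξ : Vect) : Continuous ξ.1 := ξ.2.1.continuous
  have c1 (ξ : Vect) : Continuous (deriv ξ.1) := (contDiff_deriv ξ.2.1).continuous
  have c2 (ξ : Vect) : Continuous (α.lie ξ) := (α.lie_mem_Vect ξ).1.continuous
  have c3 (ξ : Vect) : Continuous (deriv (α.lie ξ)) :=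
    (contDiff_deriv (α.lie_mem_Vect ξ).1).continuous
  have d0 (ξ : Vect) := hasDerivAt_of_contDiff ξ.2.1
  have d1 (ξ : Vect) := hasDerivAt_of_contDiff (contDiff_deriv ξ.2.1)
  have d2 (ξ : Vect) := hasDerivAt_of_contDiff (contDiff_deriv (contDiff_deriv ξ.2.1))
  have dl (ξ : Vect) := hasDerivAt_of_contDiff (α.lie_mem_Vect ξ).1
  refine integral_eq_zero_of_hasDerivAt (Z := fun x =>
    α.lie ξ₁ x * ξ₀.1 x * ξ₂.1 x + α.lie ξ₂ x * ξ₁.1 x * ξ₀.1 x + α.lie ξ₀ x * ξ₂.1 x * ξ₁.1 x +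
    (deriv (deriv ξ₁.1) x * (deriv ξ₀.1 x * ξ₂.1 x - ξ₀.1 x * deriv ξ₂.1 x) +
    deriv (deriv ξ₂.1) x * (deriv ξ₁.1 x * ξ₀.1 x - ξ₁.1 x * deriv ξ₀.1 x) +
    deriv (deriv ξ₀.1) x * (deriv ξ₂.1 x * ξ₁.1 x - ξ₂.1 x * deriv ξ₁.1 x)))
    (by have := c0 ξ₀; have := c0 ξ₁; have := c0 ξ₂; have := c1 ξ₀; have := c1 ξ₁; have := c1 ξ₂
        have := c2 ξ₀; have := c2 ξ₁; have := c2 ξ₂; have := c3 ξ₀; have := c3 ξ₁; have := c3 ξ₂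
        fun_prop) (fun x => ?_) ?_
  · have P (ξ η ζ : Vect) := ((dl ξ x).mul (d0 η x)).mul (d0 ζ x)
    have Q (ξ η ζ : Vect) := (d2 ξ x).mul (((d1 η x).mul (d0 ζ x)).sub ((d0 η x).mul (d1 ζ x)))
    refine ((((P ξ₁ ξ₀ ξ₂).add (P ξ₂ ξ₁ ξ₀)).add (P ξ₀ ξ₂ ξ₁)).add
      (((Q ξ₁ ξ₀ ξ₂).add (Q ξ₂ ξ₁ ξ₀)).add (Q ξ₀ ξ₂ ξ₁))).congr_deriv ?_
    simp only [Pi.mul_apply, Pi.sub_apply, α.lie_apply]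
    ring
  · intro x
    have p0 (ξ : Vect) := ξ.2.2 x
    have p1 (ξ : Vect) := periodic_deriv ξ.2.2 x
    have p2 (ξ : Vect) := periodic_deriv (periodic_deriv ξ.2.2) x
    have p3 (ξ : Vect) := (α.lie_mem_Vect ξ).2 x
    simp only [p0, p1, p2, p3]

/-! ### Derivatives of the form along a three-parameter family -/

section Family

variable {T : GL (Fin 2) ℝ} {F : (Fin 3 → ℝ) → PT T} {ξ : Fin 3 → (Fin 3 → ℝ) → Vect}

/-- The partial derivative of the vector field `ξⱼ` in the direction of the parameter `k`. -/
def partialField (h : IsSmoothFamily F ξ) (k j : Fin 3) (s : Fin 3 → ℝ) : Vect :=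
  ⟨fun x => dirDeriv (Pi.single k 1, 0) (fun p : (Fin 3 → ℝ) × ℝ => (ξ j p.1).1 p.2) (s, x),
    contDiff_slice (contDiff_dirDeriv (h.smooth_field j) _) s, fun x => by
      simp only
      rw [← fderiv_slice (h.smooth_field j), ← fderiv_slice (h.smooth_field j)]
      congr 2
      funext r
      exact (ξ j r).2.2 x⟩

/-- The velocity of the family in the direction of the parameter `i`. -/
def familyVelocity (F : (Fin 3 → ℝ) → PT T) (ξ : Fin 3 → (Fin 3 → ℝ) → Vect) (i : Fin 3)
    (p : (Fin 3 → ℝ) × ℝ) : ℝ := (F p.1).1.lie (ξ i p.1) p.2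

variable (h : IsSmoothFamily F ξ)
include h

theorem familyVelocity_eq_dirDeriv (i : Fin 3) :
    familyVelocity F ξ i = dirDeriv (Pi.single i 1, 0)
      (fun p : (Fin 3 → ℝ) × ℝ => (F p.1).1.schwarzian p.2) := by
  funext p
  rw [familyVelocity, ← h.velocity i p.1 p.2]
  exact fderiv_slice h.smooth p.1 (Pi.single i 1) p.2

theorem contDiff_familyVelocity (i : Fin 3) : ContDiff ℝ ∞ (familyVelocity F ξ i) := by
  rw [familyVelocity_eq_dirDeriv h]
  exact contDiff_dirDeriv h.smooth _

/-- Expressing x-derivatives as directional derivatives on parameters × line lets them be exchanged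
with parameter derivatives. -/
theorem familyVelocity_eq (i : Fin 3) :
    familyVelocity F ξ i = fun p =>
      (ξ i p.1).1 p.2 *
        dirDeriv (0, 1) (fun p : (Fin 3 → ℝ) × ℝ => (F p.1).1.schwarzian p.2) p +
      2 * (dirDeriv (0, 1) (fun p : (Fin 3 → ℝ) × ℝ => (ξ i p.1).1 p.2) p *
        (F p.1).1.schwarzian p.2) +
      dirDeriv (0, 1) (dirDeriv (0, 1) (dirDeriv (0, 1)
        (fun p : (Fin 3 → ℝ) × ℝ => (ξ i p.1).1 p.2))) p := by
  funext p
  have h1 := h.smooth_field i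
  have h2 := contDiff_dirDeriv h1 (0, 1)
  have h3 := contDiff_dirDeriv h2 (0, 1)
  have e1 : deriv (ξ i p.1).1 = _ := deriv_slice h1 p.1
  have e0 : deriv (F p.1).1.schwarzian = _ := deriv_slice h.smooth p.1
  rw [familyVelocity, ProjStr.lie_apply, e0, e1, deriv_slice h2, deriv_slice h3]
  ring

/-- The mixed second derivatives of the family. -/
theorem dirDeriv_familyVelocity (k i : Fin 3) (s : Fin 3 → ℝ) (x : ℝ) :
    dirDeriv (Pi.single k 1, 0) (familyVelocity F ξ i) (s, x) =
      (F s).1.lie (partialField h i k s) x + ((ξ k s).1 x * deriv ((F s).1.lie (ξ i s)) x +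
        2 * deriv (ξ k s).1 x * (F s).1.lie (ξ i s) x) := by
  set Q := fun p : (Fin 3 → ℝ) × ℝ => (F p.1).1.schwarzian p.2 with hQ
  set X := fun p : (Fin 3 → ℝ) × ℝ => (ξ k p.1).1 p.2 with hX
  have hQs : ContDiff ℝ ∞ Q := h.smooth
  have hXs : ContDiff ℝ ∞ X := h.smooth_field k
  have hd := contDiff_dirDeriv hXs (0, 1)
  have hdd := contDiff_dirDeriv hd (0, 1)
  have hddd := contDiff_dirDeriv hdd (0, 1)
  have hdQ := contDiff_dirDeriv hQs (0, 1)
  have hw := contDiff_dirDeriv hXs (Pi.single i 1, 0)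
  have hwd := contDiff_dirDeriv hw (0, 1)
  have e0 : deriv (F s).1.schwarzian = _ := deriv_slice hQs s
  have e1 : deriv (ξ k s).1 = _ := deriv_slice hXs s
  have e2 : deriv ((F s).1.lie (ξ i s)) = _ := deriv_slice (contDiff_familyVelocity h i) s
  have e3 : deriv (partialField h i k s).1 = _ := deriv_slice hw s
  have e4 : (F s).1.lie (ξ i s) x = familyVelocity F ξ i (s, x) := rfl
  have e5 : (F s).1.schwarzian x = Q (s, x) := rfl
  have e6 : (ξ k s).1 x = X (s, x) := rfl
  have e7 : (partialField h i k s).1 x = dirDeriv (Pi.single i 1, 0) X (s, x) := rfl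
  -- The order of ∂ₖ and ∂ᵢ is exchanged before expanding, so the field that gets differentiated is
  -- ξₖ, in direction i. This index pattern makes the cyclic cancellation possible.
  rw [ProjStr.lie_apply, e0, e1, e2, e3, deriv_slice hwd, deriv_slice (contDiff_dirDeriv hwd _),
    e4, e5, e6, e7, familyVelocity_eq_dirDeriv h i, dirDeriv_comm hQs,
    ← familyVelocity_eq_dirDeriv h k, familyVelocity_eq h k]
  rw [dirDeriv_add ((hXs.mul hdQ).add (contDiff_const.mul (hd.mul hQs))) hddd,
    dirDeriv_add (hXs.mul hdQ) (contDiff_const.mul (hd.mul hQs)), dirDeriv_mul hXs hdQ,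
    dirDeriv_const_mul (hd.mul hQs), dirDeriv_mul hd hQs]
  rw [dirDeriv_comm hdd (Pi.single i 1, 0), dirDeriv_comm hd (Pi.single i 1, 0),
    dirDeriv_comm hXs (Pi.single i 1, 0), dirDeriv_comm hQs (Pi.single i 1, 0)]
  ring

theorem contDiff_form_integrand (i j : Fin 3) :
    ContDiff ℝ ∞ fun p : (Fin 3 → ℝ) × ℝ => familyVelocity F ξ i p * (ξ j p.1).1 p.2 :=
  (contDiff_familyVelocity h i).mul (h.smooth_field j)

/-- Skew-adjointness brings both terms with differentiated fields to the shape ∫ L(∂ₐξ_b) ξ_c; over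
cyclic permutations of (k, i, j) they cancel in pairs, leaving the integrals of
`integral_cocycle_eq_zero`. -/
theorem fderiv_form (k i j : Fin 3) (s : Fin 3 → ℝ) :
    fderiv ℝ (fun s => ∫ x in (0 : ℝ)..(2 * Real.pi), familyVelocity F ξ i (s, x) * (ξ j s).1 x) s
        (Pi.single k 1) =
      (∫ x in (0 : ℝ)..(2 * Real.pi), (F s).1.lie (partialField h i k s) x * (ξ j s).1 x) +
      (∫ x in (0 : ℝ)..(2 * Real.pi), ((ξ k s).1 x * deriv ((F s).1.lie (ξ i s)) x +
        2 * deriv (ξ k s).1 x * (F s).1.lie (ξ i s) x) * (ξ j s).1 x) -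
      ∫ x in (0 : ℝ)..(2 * Real.pi), (F s).1.lie (partialField h k j s) x * (ξ i s).1 x := by
  have hl (ζ : Vect) := (F s).1.lie_mem_Vect ζ
  have c1 : Continuous fun x => (F s).1.lie (partialField h i k s) x * (ξ j s).1 x :=
    continuous_of_mem_Vect (mul_mem_Vect (hl _) (ξ j s).2)
  have c2 : Continuous fun x => ((ξ k s).1 x * deriv ((F s).1.lie (ξ i s)) x +
      2 * deriv (ξ k s).1 x * (F s).1.lie (ξ i s) x) * (ξ j s).1 x := by
    have := continuous_of_mem_Vect (ξ k s).2
    have := continuous_of_mem_Vect (ξ j s).2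
    have := continuous_of_mem_Vect (deriv_mem_Vect (ξ k s).2)
    have := continuous_of_mem_Vect (hl (ξ i s))
    have := continuous_of_mem_Vect (deriv_mem_Vect (hl (ξ i s)))
    fun_prop
  have c3 : Continuous fun x => (F s).1.lie (ξ i s) x * (partialField h k j s).1 x :=
    continuous_of_mem_Vect (mul_mem_Vect (hl _) (partialField h k j s).2)
  rw [fderiv_parametric_integral (contDiff_form_integrand h i j),
    integral_lie_mul_antisymm _ (partialField h k j s), sub_neg_eq_add,
    ← integral_add_add c1 c2 c3]
  congr 1
  funext x
  rw [dirDeriv_mul (contDiff_familyVelocity h i) (h.smooth_field j), dirDeriv_familyVelocity h]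
  change _ + (F s).1.lie (ξ i s) x * (partialField h k j s).1 x = _
  ring

theorem closed_of_isSmoothFamily {Ω : Fin 3 → Fin 3 → (Fin 3 → ℝ) → ℝ}
    (hΩ : ∀ i j s, Ω i j s = (F s).1.form ((F s).1.vel (ξ i s)) ((F s).1.vel (ξ j s))) :
    (∀ i j, ContDiff ℝ ∞ (Ω i j)) ∧
      ∀ s, fderiv ℝ (Ω 1 2) s (Pi.single 0 1) + fderiv ℝ (Ω 2 0) s (Pi.single 1 1)
        + fderiv ℝ (Ω 0 1) s (Pi.single 2 1) = 0 := by
  have e : ∀ i j, Ω i j = fun s =>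
      ∫ x in (0 : ℝ)..(2 * Real.pi), familyVelocity F ξ i (s, x) * (ξ j s).1 x := by
    intro i j
    funext s
    rw [hΩ, ProjStr.form_vel]
    rfl
  refine ⟨fun i j => ?_, fun s => ?_⟩
  · rw [e]
    exact contDiff_parametric_integral (contDiff_form_integrand h i j) _ _
  · have hc (k i j : Fin 3) : Continuous fun x =>
        ((ξ k s).1 x * deriv ((F s).1.lie (ξ i s)) x +
          2 * deriv (ξ k s).1 x * (F s).1.lie (ξ i s) x) * (ξ j s).1 x := by
      have := continuous_of_mem_Vect (ξ k s).2
      have := continuous_of_mem_Vect (ξ j s).2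
      have := continuous_of_mem_Vect (deriv_mem_Vect (ξ k s).2)
      have := continuous_of_mem_Vect ((F s).1.lie_mem_Vect (ξ i s))
      have := continuous_of_mem_Vect (deriv_mem_Vect ((F s).1.lie_mem_Vect (ξ i s)))
      fun_prop
    have key := integral_cocycle_eq_zero (F s).1 (ξ 0 s) (ξ 1 s) (ξ 2 s)
    rw [integral_add_add (hc 0 1 2) (hc 1 2 0) (hc 2 0 1)] at key
    rw [e, e, e, fderiv_form h, fderiv_form h, fderiv_form h]
    linarith

end Family

theorem form_isSmoothClosed (T : GL (Fin 2) ℝ) :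
    IsSmoothClosed (T := T) fun α => α.1.form :=
  fun _ _ h _ hΩ => closed_of_isSmoothFamily h hΩ

end CircleProj

end

theorem mainTheorem7 (T : GL (Fin 2) ℝ) :
    -- every tangent vector is represented by a vector field that vanishes at a suitable point
    (∀ α : CircleProj.PT T, ∃ x₀ : ℝ, ∀ δ : α.1.Tangent, ∃ ξ : CircleProj.Vect,
      ξ.1 x₀ = 0 ∧ α.1.vel ξ = δ) ∧
    ∃ σ : ∀ α : CircleProj.PT T, LinearMap.BilinForm ℝ α.1.Tangent,
      -- the integral does not depend on any choice, and it defines the form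
      CircleProj.IsGivenByIntegral (fun α δ₁ δ₂ => σ α δ₁ δ₂) ∧
      (∀ σ' : ∀ α : CircleProj.PT T, α.1.Tangent → α.1.Tangent → ℝ,
        CircleProj.IsGivenByIntegral σ' → ∀ α δ₁ δ₂, σ' α δ₁ δ₂ = σ α δ₁ δ₂) ∧
      -- it is an ordinary integral when the parameter is finite along the developing map
      (∀ (α : CircleProj.PT T) (φ : CircleProj.DevMap), φ.struct = α.1 →
        ∀ (g : GL (Fin 2) ℝ) (x₀ : ℝ) (ξ₁ ξ₂ : CircleProj.Vect), ξ₁.1 x₀ = 0 → ξ₂.1 x₀ = 0 →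
        (∀ x ∈ Set.Ioo x₀ (x₀ + 2 * Real.pi), g • φ.toFun x ≠ OnePoint.infty) →
        IntervalIntegrable (CircleProj.density (CircleProj.pullForm g φ) ξ₁.1 ξ₂.1) volume
          x₀ (x₀ + 2 * Real.pi) ∧
        ∫ x in x₀..(x₀ + 2 * Real.pi), CircleProj.density (CircleProj.pullForm g φ) ξ₁.1 ξ₂.1 x
          = σ α (α.1.vel ξ₁) (α.1.vel ξ₂)) ∧
      -- it is a closed nondegenerate 2-form
      (∀ α, (σ α).IsAlt) ∧
      CircleProj.IsSmoothClosed σ ∧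
      (∀ α, (σ α).Nondegenerate) ∧
      -- the formula with the Schwarzian derivative
      (∀ (α : CircleProj.PT T) (φ : CircleProj.DevMap), φ.struct = α.1 →
        ∀ ξ₁ ξ₂ : CircleProj.Vect,
        σ α (α.1.vel ξ₁) (α.1.vel ξ₂) =
          -(∫ x in (0 : ℝ)..(2 * Real.pi), CircleProj.schwarz φ.toFun x *
              (ξ₁.1 x * deriv ξ₂.1 x - deriv ξ₁.1 x * ξ₂.1 x))
          + ∫ x in (0 : ℝ)..(2 * Real.pi), deriv ξ₁.1 x * deriv (deriv ξ₂.1) x) := by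
  refine ⟨CircleProj.exists_point_representing, fun α => α.1.form,
    CircleProj.form_isGivenByIntegral T,
    fun σ' h' => CircleProj.isGivenByIntegral_unique (CircleProj.form_isGivenByIntegral T) h',
    fun α φ hφ g x₀ ξ₁ ξ₂ h₁ h₂ hfin => CircleProj.form_eq_ordinary_integral hφ g h₁ h₂ hfin,
    fun α => α.1.form_isAlt, CircleProj.form_isSmoothClosed T,
    fun α => α.1.form_nondegenerate, fun α φ hφ ξ₁ ξ₂ => ?_⟩
  have hq : α.1.schwarzian = CircleProj.schwarz φ.toFun := by rw [← hφ]; rfl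
  have c₁ := CircleProj.continuous_of_mem_Vect ξ₁.2
  have c₂ := CircleProj.continuous_of_mem_Vect ξ₂.2
  have d₁ := CircleProj.continuous_of_mem_Vect (CircleProj.deriv_mem_Vect ξ₁.2)
  have d₂ := CircleProj.continuous_of_mem_Vect (CircleProj.deriv_mem_Vect ξ₂.2)
  have dd₂ := CircleProj.continuous_of_mem_Vect
    (CircleProj.deriv_mem_Vect (CircleProj.deriv_mem_Vect ξ₂.2))
  have cq := (CircleProj.contDiff_schwarz φ.immersion).continuous
  rw [CircleProj.ProjStr.form_vel_eq_base, hq, ← intervalIntegral.integral_neg,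
    ← intervalIntegral.integral_add]
  · rfl
  · exact Continuous.intervalIntegrable (by fun_prop) _ _
  · exact (d₁.mul dd₂).intervalIntegrable _ _
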